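/- Let $X$ be a Riemannian manifold of dimension $m\ge 1$ and let $J^2(X)\cong \mathbf R\oplus T^*X\oplus \mathrm{Sym}^2(T^*X)$ be its $2$-jet bundle, with points $(x,r,p,A)$, split by the Levi-Civita connection, so that $J^2_xu=(x,u(x),\mathrm du(x),\nabla \mathrm du(x))$. A subset $F\subset J^2(X)$ is a *subequation* if $F_x+(0,0,P)\subset F_x$ for $P\ge 0$, $F_x+(r,0,0)\subset F_x$ for $r\le 0$, and $F=\overline{\mathrm{Int}\,F}$, $F_x=\overline{\mathrm{Int}\,F_x}$, $(\mathrm{Int}\,F)_x=\mathrm{Int}\,F_x$ for every $x$. Its dual is $\widetilde F=-(\sim \mathrm{Int}\,F)$, and for $c>0$ let $F^c_x=\{J\in F_x:\ \mathrm{dist}(J,\partial F_x)\ge c\}$, the distance being that of the metric norm on $J^2_x(X)$. For $K\subset X$ compact let $USC(K)$ be the set of upper semicontinuous $[-\infty,+\infty)$-valued functions on $K$. For $G\subset J^2(X)$ let $G(K)$ be the set of $u\in USC(K)$ such that $J^2_x\phi\in G$ whenever $x\in\mathrm{Int}\,K$, $\phi$ is $C^2$ near $x$, $\phi\ge u$ near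 $x$ and $\phi(x)=u(x)$. Let $F^{\mathrm{str}}(K)$ be the set of $u\in USC(K)$ such that each point of $\mathrm{Int}\,K$ has a neighbourhood $B$ and some $c>0$ for which this test condition holds at the points of $B$ with $G=F^c$. On an open set $\Omega\subset X$, $F$ satisfies * *strict approximation* if for each compact $K\subset\Omega$ each $u\in F(K)$ is a uniform limit on $K$ of functions in $F^{\mathrm{str}}(K)$; * *weak comparison* if for each compact $K\subset\Omega$, $c>0$, $u\in F^c(K)$ and $v\in\widetilde F(K)$, $u+v\le 0$ on $\partial K$ implies $u+v\le 0$ on $K$. **Lemma.** Let $F\subset J^2(X)$ be a subequation, let $g\in C(X)$, let $F^g=F\cap\{r\le g(x)\}$ be the associated obstacle subequation, and let $\Omega\subset X$ be open (for instance $\Omega=X$, or $\Omega$ relatively compact). Then 1. if $F$ satisfies strict approximation on $\Omega$, so does $F^g$; 2. suppose that the set of $x\in\Omega$ with $F_x=J^2_x(X)$ is open (for instance empty, that is, $F$ imposes a genuine constraint at every point of $\Omega$); if $F$ satisfies weak comparison on $\Omega$, so does $F^g$. -/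

import Mathlib

open Bundle
open scoped Manifold Bundle ContDiff Topology

noncomputable section

namespace Subeq

section Jets

variable {m : ℕ} {X : Type*} [TopologicalSpace X] [ChartedSpace (EuclideanSpace ℝ (Fin m)) X]
  [IsManifold (𝓡 m) ∞ X]

instance finiteDimensional_tangentSpace (x : X) :
    FiniteDimensional ℝ (TangentSpace (𝓡 m) x) :=
  inferInstanceAs (FiniteDimensional ℝ (EuclideanSpace ℝ (Fin m)))

/-- `Sym²(T*ₓX)`: the symmetric bilinear forms on the tangent space at `x`. -/
def SymForm (x : X) :
    Submodule ℝ (TangentSpace (𝓡 m) x →L[ℝ] TangentSpace (𝓡 m) x →L[ℝ] ℝ) where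
  carrier := {A | ∀ v w, A v w = A w v}
  add_mem' {A B} hA hB v w := by
    change A v w + B v w = A w v + B w v
    rw [hA v w, hB v w]
  zero_mem' _ _ := rfl
  smul_mem' c A hA v w := by
    change c • A v w = c • A w v
    rw [hA v w]

/-- The fibre `J²ₓ(X) = ℝ ⊕ T*ₓX ⊕ Sym²(T*ₓX)`, with elements `(r, p, A)`. -/
abbrev JetFiber (x : X) : Type :=
  ℝ × (TangentSpace (𝓡 m) x →L[ℝ] ℝ) × SymForm (m := m) x

set_option synthInstance.maxHeartbeats 200000 in
instance (x : X) :
    AddCommGroup (TangentSpace (𝓡 m) x →L[ℝ] TangentSpace (𝓡 m) x →L[ℝ] ℝ) :=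
  inferInstance

instance (x : X) : AddCommGroup (SymForm (m := m) x) := inferInstance

variable (m X) in
/-- The `2`-jet bundle `J²(X) ≅ ℝ ⊕ T*X ⊕ Sym²(T*X)`. -/
@[ext] structure Jet2 where
  /-- the base point -/
  pt : X
  /-- the element `(r, p, A)` of the fibre over the base point -/
  jet : JetFiber (m := m) pt

/-- The three components `r`, `(x, p) ∈ T*X` and `(x, A) ∈ T*X ⊗ T*X` of a jet. -/
def Jet2.components (J : Jet2 m X) :
    ℝ × TotalSpace (EuclideanSpace ℝ (Fin m) →L[ℝ] ℝ)
        (fun x : X => TangentSpace (𝓡 m) x →L[ℝ] ℝ) ×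
      TotalSpace (EuclideanSpace ℝ (Fin m) →L[ℝ] EuclideanSpace ℝ (Fin m) →L[ℝ] ℝ)
        (fun x : X => TangentSpace (𝓡 m) x →L[ℝ] TangentSpace (𝓡 m) x →L[ℝ] ℝ) :=
  (J.jet.1, ⟨J.pt, J.jet.2.1⟩, ⟨J.pt, J.jet.2.2.1⟩)

/-- The topology of the vector bundle `ℝ ⊕ T*X ⊕ Sym²(T*X)`: the one induced by the components. -/
instance : TopologicalSpace (Jet2 m X) :=
  TopologicalSpace.induced Jet2.components inferInstance

/-- The fibre `Fₓ` of a subset `F ⊂ J²(X)`. -/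
def fiber (F : Set (Jet2 m X)) (x : X) : Set (JetFiber (m := m) x) := {j | (⟨x, j⟩ : Jet2 m X) ∈ F}

/-- The boundary `∂Fₓ` of `Fₓ` in the fibre `J²ₓ(X)`. -/
def fiberBoundary (F : Set (Jet2 m X)) (x : X) : Set (JetFiber (m := m) x) :=
  frontier (fiber F x)

/-- Subequations: closed under adding `(0, 0, P)` with `P ≥ 0` (positivity) and `(r, 0, 0)` with
`r ≤ 0` (negativity), together with the topological condition (T). -/
structure IsSubequation (F : Set (Jet2 m X)) : Prop where
  pos : ∀ (x : X) (j : JetFiber (m := m) x) (P : SymForm (m := m) x),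
    (∀ v, 0 ≤ P.1 v v) → j ∈ fiber F x → j + (0, 0, P) ∈ fiber F x
  neg : ∀ (x : X) (j : JetFiber (m := m) x) (r : ℝ),
    r ≤ 0 → j ∈ fiber F x → j + (r, 0, 0) ∈ fiber F x
  eq_closure_interior : F = closure (interior F)
  fiber_eq : ∀ x : X, fiber F x = closure (interior (fiber F x))
  fiber_interior : ∀ x : X, fiber (interior F) x = interior (fiber F x)

/-- The Dirichlet dual `F~ = -(∼ Int F)`. -/
def dual (F : Set (Jet2 m X)) : Set (Jet2 m X) := {J | (⟨J.pt, -J.jet⟩ : Jet2 m X) ∉ interior F}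

/-- The obstacle subset `F^g = F ∩ {r ≤ g(x)}`. -/
def obstacle (F : Set (Jet2 m X)) (g : X → ℝ) : Set (Jet2 m X) := F ∩ {J | J.jet.1 ≤ g J.pt}

lemma extend_add (x : X) (v v' : TangentSpace (𝓡 m) x) :
    (FiberBundle.extend (EuclideanSpace ℝ (Fin m)) (v + v') : ∀ y : X, TangentSpace (𝓡 m) y)
      =ᶠ[𝓝 x] FiberBundle.extend (EuclideanSpace ℝ (Fin m)) v +
        FiberBundle.extend (EuclideanSpace ℝ (Fin m)) v' := by
  set t := trivializationAt (EuclideanSpace ℝ (Fin m)) (fun y : X => TangentSpace (𝓡 m) y) x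
    with ht
  have h : x ∈ t.baseSet := FiberBundle.mem_baseSet_trivializationAt' x
  filter_upwards [t.open_baseSet.mem_nhds h] with y hy
  simp only [FiberBundle.extend, Pi.add_apply, ← ht]
  rw [(t.linear ℝ h).map_add, ← t.symmₗ_apply (R := ℝ) hy, ← t.symmₗ_apply (R := ℝ) hy, ← t.symmₗ_apply (R := ℝ) hy,
    map_add]

lemma extend_smul (x : X) (c : ℝ) (v : TangentSpace (𝓡 m) x) :
    (FiberBundle.extend (EuclideanSpace ℝ (Fin m)) (c • v) : ∀ y : X, TangentSpace (𝓡 m) y)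
      =ᶠ[𝓝 x] c • FiberBundle.extend (EuclideanSpace ℝ (Fin m)) v := by
  set t := trivializationAt (EuclideanSpace ℝ (Fin m)) (fun y : X => TangentSpace (𝓡 m) y) x
    with ht
  have h : x ∈ t.baseSet := FiberBundle.mem_baseSet_trivializationAt' x
  filter_upwards [t.open_baseSet.mem_nhds h] with y hy
  simp only [FiberBundle.extend, Pi.smul_apply, ← ht]
  rw [(t.linear ℝ h).map_smul, ← t.symmₗ_apply (R := ℝ) hy, ← t.symmₗ_apply (R := ℝ) hy, map_smul]

lemma mvfderiv_congr {f h : X → ℝ} {x : X} (e : f =ᶠ[𝓝 x] h) :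
    mvfderiv (𝓡 m) f x = mvfderiv (𝓡 m) h x := by
  ext v
  change (mfderiv (𝓡 m) 𝓘(ℝ) f x) v = (mfderiv (𝓡 m) 𝓘(ℝ) h x) v
  rw [e.mfderiv_eq]
  rfl

end Jets

section Riemannian

variable {m : ℕ} {X : Type*} [TopologicalSpace X] [ChartedSpace (EuclideanSpace ℝ (Fin m)) X]
  [IsManifold (𝓡 m) ∞ X] [RiemannianBundle (fun x : X => TangentSpace (𝓡 m) x)]

/-- The norm on `J²ₓ(X)` given by the Riemannian metric: `|(r, p, A)|² = r² + |p|² + |A|²`, where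
`|p|` is the dual norm and `|A|² = ∑ᵢⱼ A(eᵢ, eⱼ)²` for an orthonormal basis `(eᵢ)` of `TₓX`.
The distance of the Sasaki metric on the fibre is `|j - j'|`. -/
def jetNorm {x : X} (j : JetFiber (m := m) x) : ℝ :=
  let e := stdOrthonormalBasis ℝ (TangentSpace (𝓡 m) x)
  √(j.1 ^ 2 + ‖j.2.1‖ ^ 2 + ∑ i, ∑ k, (j.2.2.1 (e i) (e k)) ^ 2)

/-- `Fᶜ`, with fibres `{j ∈ Fₓ : dist(j, ∂Fₓ) ≥ c}` (no condition on the distance if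
`∂Fₓ = ∅`). -/
def strictPart (F : Set (Jet2 m X)) (c : ℝ) : Set (Jet2 m X) :=
  {J | J ∈ F ∧ ∀ j' ∈ fiberBoundary F J.pt, c ≤ jetNorm (J.jet - j')}

/-- The Riemannian gradient of a function. -/
def grad (u : X → ℝ) (x : X) : TangentSpace (𝓡 m) x :=
  haveI : CompleteSpace (TangentSpace (𝓡 m) x) := FiniteDimensional.complete ℝ _
  (InnerProductSpace.toDual ℝ (TangentSpace (𝓡 m) x)).symm (mvfderiv (𝓡 m) u x)

/-- The value `∇du(v, w)` of the Hessian of `u` for the Levi-Civita connection, by Koszul's formula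
`2 ∇du(V, W) = (𝓛_G g)(V, W) = G⟨V, W⟩ - ⟨[G, V], W⟩ - ⟨V, [G, W]⟩` with `G = grad u`, where `V, W`
are smooth vector fields near `x` that extend `v, w`. -/
def hessAux (u : X → ℝ) (x : X) (v w : TangentSpace (𝓡 m) x) : ℝ :=
  let G : ∀ y : X, TangentSpace (𝓡 m) y := grad u
  let V : ∀ y : X, TangentSpace (𝓡 m) y := FiberBundle.extend (EuclideanSpace ℝ (Fin m)) v
  let W : ∀ y : X, TangentSpace (𝓡 m) y := FiberBundle.extend (EuclideanSpace ℝ (Fin m)) w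
  (1 / 2) * (mvfderiv (𝓡 m) (fun y => inner ℝ (V y) (W y)) x (G x)
    - inner ℝ (VectorField.mlieBracket (𝓡 m) G V x) w
    - inner ℝ v (VectorField.mlieBracket (𝓡 m) G W x))

lemma hessAux_comm (u : X → ℝ) (x : X) (v w : TangentSpace (𝓡 m) x) :
    hessAux u x v w = hessAux u x w v := by
  have h : (fun y : X => inner ℝ
        (FiberBundle.extend (EuclideanSpace ℝ (Fin m)) v y : TangentSpace (𝓡 m) y)
        (FiberBundle.extend (EuclideanSpace ℝ (Fin m)) w y)) =
      fun y : X => inner ℝ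
        (FiberBundle.extend (EuclideanSpace ℝ (Fin m)) w y : TangentSpace (𝓡 m) y)
        (FiberBundle.extend (EuclideanSpace ℝ (Fin m)) v y) :=
    funext fun y => real_inner_comm _ _
  simp only [hessAux]
  rw [h, real_inner_comm w, real_inner_comm _ v]
  ring

variable [IsContMDiffRiemannianBundle (𝓡 m) ∞ (EuclideanSpace ℝ (Fin m))
    (fun x : X => TangentSpace (𝓡 m) x)]

lemma hessAux_add (u : X → ℝ) (x : X) (v v' w : TangentSpace (𝓡 m) x) :
    hessAux u x (v + v') w = hessAux u x v w + hessAux u x v' w := by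
  have : IsContMDiffRiemannianBundle (𝓡 m) 1 (EuclideanSpace ℝ (Fin m))
      (fun x : X => TangentSpace (𝓡 m) x) :=
    IsContMDiffRiemannianBundle.of_le (n := ∞) (by exact_mod_cast le_top)
  have hd : ∀ z : TangentSpace (𝓡 m) x, MDifferentiableAt (𝓡 m) (𝓡 m).tangent
      (fun y => (⟨y, FiberBundle.extend (EuclideanSpace ℝ (Fin m)) z y⟩ :
        TangentBundle (𝓡 m) X)) x :=
    fun z => FiberBundle.mdifferentiableAt_extend (𝓡 m) (EuclideanSpace ℝ (Fin m)) z
  have he := extend_add x v v'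
  have h : (fun y : X => inner ℝ
        (FiberBundle.extend (EuclideanSpace ℝ (Fin m)) (v + v') y : TangentSpace (𝓡 m) y)
        (FiberBundle.extend (EuclideanSpace ℝ (Fin m)) w y)) =ᶠ[𝓝 x]
      fun y : X => inner ℝ
        (FiberBundle.extend (EuclideanSpace ℝ (Fin m)) v y : TangentSpace (𝓡 m) y)
        (FiberBundle.extend (EuclideanSpace ℝ (Fin m)) w y) + inner ℝ
        (FiberBundle.extend (EuclideanSpace ℝ (Fin m)) v' y : TangentSpace (𝓡 m) y)
        (FiberBundle.extend (EuclideanSpace ℝ (Fin m)) w y) := by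
    filter_upwards [he] with y hy
    rw [hy, Pi.add_apply, inner_add_left]
  have hb : VectorField.mlieBracket (𝓡 m) (grad u)
        (FiberBundle.extend (EuclideanSpace ℝ (Fin m)) (v + v')) x =
      VectorField.mlieBracket (𝓡 m) (grad u)
        (FiberBundle.extend (EuclideanSpace ℝ (Fin m)) v) x +
      VectorField.mlieBracket (𝓡 m) (grad u)
        (FiberBundle.extend (EuclideanSpace ℝ (Fin m)) v') x := by
    rw [← VectorField.mlieBracket_add_right (hd v) (hd v')]
    exact Filter.EventuallyEq.mlieBracket_vectorField_eq (Filter.EventuallyEq.refl _ _) he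
  simp only [hessAux]
  rw [hb, mvfderiv_congr h,
    mvfderiv_fun_add ((hd v).inner_bundle (hd w)) ((hd v').inner_bundle (hd w))]
  simp only [inner_add_left, add_apply]
  ring

lemma hessAux_smul (u : X → ℝ) (x : X) (c : ℝ) (v w : TangentSpace (𝓡 m) x) :
    hessAux u x (c • v) w = c • hessAux u x v w := by
  have : IsContMDiffRiemannianBundle (𝓡 m) 1 (EuclideanSpace ℝ (Fin m))
      (fun x : X => TangentSpace (𝓡 m) x) :=
    IsContMDiffRiemannianBundle.of_le (n := ∞) (by exact_mod_cast le_top)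
  have hd : ∀ z : TangentSpace (𝓡 m) x, MDifferentiableAt (𝓡 m) (𝓡 m).tangent
      (fun y => (⟨y, FiberBundle.extend (EuclideanSpace ℝ (Fin m)) z y⟩ :
        TangentBundle (𝓡 m) X)) x :=
    fun z => FiberBundle.mdifferentiableAt_extend (𝓡 m) (EuclideanSpace ℝ (Fin m)) z
  have he := extend_smul x c v
  have h : (fun y : X => inner ℝ
        (FiberBundle.extend (EuclideanSpace ℝ (Fin m)) (c • v) y : TangentSpace (𝓡 m) y)
        (FiberBundle.extend (EuclideanSpace ℝ (Fin m)) w y)) =ᶠ[𝓝 x]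
      fun y : X => c * inner ℝ
        (FiberBundle.extend (EuclideanSpace ℝ (Fin m)) v y : TangentSpace (𝓡 m) y)
        (FiberBundle.extend (EuclideanSpace ℝ (Fin m)) w y) := by
    filter_upwards [he] with y hy
    rw [hy, Pi.smul_apply, real_inner_smul_left]
  have hb : VectorField.mlieBracket (𝓡 m) (grad u)
        (FiberBundle.extend (EuclideanSpace ℝ (Fin m)) (c • v)) x =
      c • VectorField.mlieBracket (𝓡 m) (grad u)
        (FiberBundle.extend (EuclideanSpace ℝ (Fin m)) v) x := by
    rw [← VectorField.mlieBracket_const_smul_right (hd v)]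
    exact Filter.EventuallyEq.mlieBracket_vectorField_eq (Filter.EventuallyEq.refl _ _) he
  simp only [hessAux]
  rw [hb, mvfderiv_congr h,
    mvfderiv_fun_mul mdifferentiableAt_const ((hd v).inner_bundle (hd w)), mvfderiv_const]
  simp [real_inner_smul_left]
  ring

/-- The Hessian `∇du` at `x`, as an element of `Sym²(T*ₓX)`. -/
def hess (u : X → ℝ) (x : X) : SymForm (m := m) x where
  val := IsBilinearMap.toContinuousBilinearMap (f := hessAux u x)
    { add_left := hessAux_add u x
      smul_left := hessAux_smul u x
      add_right := fun v w w' => by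
        rw [hessAux_comm u x v (w + w'), hessAux_add, hessAux_comm u x w, hessAux_comm u x w']
      smul_right := fun c v w => by
        rw [hessAux_comm u x v (c • w), hessAux_smul, hessAux_comm u x w] }
  property := hessAux_comm u x

/-- The `2`-jet `J²ₓu = (x, u(x), du(x), ∇du(x))`. -/
def jetOf (u : X → ℝ) (x : X) : Jet2 m X := ⟨x, u x, mvfderiv (𝓡 m) u x, hess u x⟩

variable (m) in
/-- `φ` is a test for `u` at `x`: it is `C²` in a neighbourhood of `x`, `φ ≥ u` around `x`, and
`φ(x) = u(x)`. -/
def IsTest (u : X → EReal) (x : X) (φ : X → ℝ) : Prop :=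
  ContMDiffAt (𝓡 m) 𝓘(ℝ) 2 φ x ∧ (∀ᶠ y in 𝓝 x, u y ≤ φ y) ∧ (φ x : EReal) = u x

/-- The test function condition that defines `u ∈ F(U)`. -/
def TestsIn (F : Set (Jet2 m X)) (U : Set X) (u : X → EReal) : Prop :=
  ∀ x ∈ U, ∀ φ : X → ℝ, IsTest m u x φ → jetOf φ x ∈ F

/-- `u ∈ USC(K)`: upper semicontinuous on `K` with values in `[-∞, +∞)`. Only the values of `u` on
`K` matter. -/
def IsUSC (K : Set X) (u : X → EReal) : Prop :=
  UpperSemicontinuousOn u K ∧ ∀ x ∈ K, u x < ⊤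

/-- `F(K) = USC(K) ∩ F(Int K)`. -/
def Sub (F : Set (Jet2 m X)) (K : Set X) : Set (X → EReal) :=
  {u | IsUSC K u ∧ TestsIn F (interior K) u}

/-- `F^str(K)`: the functions in `USC(K)` that are strictly `F`-subharmonic on `Int K`, i.e. near
each point of `Int K` they satisfy the test function condition for some `Fᶜ`, `c > 0`. -/
def StrictSub (F : Set (Jet2 m X)) (K : Set X) : Set (X → EReal) :=
  {u | IsUSC K u ∧ ∀ x ∈ interior K, ∃ B ∈ 𝓝 x, ∃ c > 0, TestsIn (strictPart F c) B u}

/-- `F` satisfies strict approximation on the open set `Ω`: for each compact `K ⊂ Ω`, each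
`u ∈ F(K)` is a uniform limit on `K` of functions in `F^str(K)`. -/
def StrictApproximation (F : Set (Jet2 m X)) (Ω : Set X) : Prop :=
  ∀ K ⊆ Ω, IsCompact K → ∀ u ∈ Sub F K, ∀ ε : ℝ, 0 < ε →
    ∃ w ∈ StrictSub F K, ∀ x ∈ K, u x ≤ w x + ε ∧ w x ≤ u x + ε

/-- `F` satisfies weak comparison on the open set `Ω`: for each compact `K ⊂ Ω`, `c > 0`,
`u ∈ Fᶜ(K)` and `v ∈ F~(K)`, if `u + v ≤ 0` on `∂K` then `u + v ≤ 0` on `K`. -/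
def WeakComparison (F : Set (Jet2 m X)) (Ω : Set X) : Prop :=
  ∀ K ⊆ Ω, IsCompact K → ∀ c : ℝ, 0 < c → ∀ u ∈ Sub (strictPart F c) K, ∀ v ∈ Sub (dual F) K,
    (∀ x ∈ frontier K, u x + v x ≤ 0) → ∀ x ∈ K, u x + v x ≤ 0

end Riemannian

end Subeq

end

set_option linter.unusedSectionVars false

namespace Subeq

/-! ### Tensoriality of the Koszul expression for the Hessian -/

section Geometry

variable {m : ℕ} {X : Type*} [TopologicalSpace X] [ChartedSpace (EuclideanSpace ℝ (Fin m)) X]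
  [IsManifold (𝓡 m) ∞ X]

/-! Both parts rest on two facts. A jet of `F^g` at distance at least `c` from the boundary is a jet
of `F` with the same property whose value is at most `g - c`, and conversely. A test jet for `v ∈
dual (F^g)` whose value exceeds `-g` lies in the dual of `F`. An upper bound at test points holds
everywhere for a usc function (`le_of_forall_isTest`), so `u ≤ g` for `u ∈ F^g(K)`, and `u ≤ g - c`
in the strict case, on the interior of `K`.

Strict approximation: approximate `u` by a strict `w` within ε/4 and lower `w` by ε/2. Negativity
keeps it strict for `F`, and it now stays ε/4 below `g`.

Weak comparison: suppose that `u + v` has a positive maximum, necessarily at an interior point `x`.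
The device is a `C²` function `θ` near `x` whose jets avoid `F`: then `-θ` is dual subharmonic, and
so is `max(v - s, -θ)` if `θ - s < g`, because wherever `v - s` is the larger term the obstacle is
inactive (`testsIn_dual_sup`). Such `θ` comes from a single jet outside `F` at `x`, since every jet
is the jet of a function, `F` is closed and jets of `C²` functions vary continuously. Comparison for
`F` is then applied on a small compact neighbourhood of `x`. There are three cases.

If the fibre of `F` at `x` is everything, the same holds nearby by the openness hypothesis. The dual
of `F` is empty there, so `v ≤ -g` and `u + v ≤ -c`.

If some jet with value below `g x` is outside `F`, take `s = 0` and `g - c < θ < g`. Perturbing `u`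
by a small multiple of a function with a strict minimum at `x` makes the maximum strict, and
comparison is contradicted (`false_of_notMem_of_lt_obstacle`).

Otherwise the fibre contains all jets below `g x` but not all jets. Comparing `v` with a point mass
at `x` bounds `v x` by `-g x` up to an arbitrarily small error
(`value_le_of_forall_lt_obstacle_mem`). -/

theorem contMDiffAt_mvfderiv_apply {u : X → ℝ} {V : ∀ y : X, TangentSpace (𝓡 m) y} {x : X}
    (hu : ContMDiffAt (𝓡 m) 𝓘(ℝ) 2 u x)
    (hV : ContMDiffAt (𝓡 m) (𝓡 m).tangent 1 (fun y => (⟨y, V y⟩ : TangentBundle (𝓡 m) X)) x) :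
    ContMDiffAt (𝓡 m) 𝓘(ℝ) 1 (fun y => mvfderiv (𝓡 m) u y (V y)) x := by
  have : IsManifold (𝓡 m) 1 X := IsManifold.of_le (n := ∞) (by exact_mod_cast le_top)
  have h1 := hu.mfderiv_const (m := 1) (by norm_num)
  have h2 := ContMDiffAt.clm_apply_of_inCoordinates (b₁ := id) (b₂ := u)
    (E₁ := fun y : X => TangentSpace (𝓡 m) y) (E₂ := fun y : ℝ => TangentSpace 𝓘(ℝ) y)
    (ϕ := fun y => mfderiv (𝓡 m) 𝓘(ℝ) u y) (v := V) h1 hV (hu.of_le (by norm_num))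
  rw [contMDiffAt_totalSpace] at h2
  have h3 := h2.2
  simpa using! h3

/-- Replacing `V` by `f V`, the term `(G f)⟨V, W⟩` from the derivative cancels the one from `[G, f
V] = f [G, V] + (G f) V`. -/
theorem tensorialAt_koszul_left [RiemannianBundle (fun x : X => TangentSpace (𝓡 m) x)]
    [IsContMDiffRiemannianBundle (𝓡 m) ∞ (EuclideanSpace ℝ (Fin m))
      (fun x : X => TangentSpace (𝓡 m) x)]
    (G W : ∀ y : X, TangentSpace (𝓡 m) y) (x : X)
    (hW : MDifferentiableAt (𝓡 m) (𝓡 m).tangent (fun y => (⟨y, W y⟩ : TangentBundle (𝓡 m) X)) x) :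
    TensorialAt (𝓡 m) (EuclideanSpace ℝ (Fin m))
      (fun V : ∀ y : X, TangentSpace (𝓡 m) y =>
        mvfderiv (𝓡 m) (fun y => inner ℝ (V y) (W y)) x (G x)
        - inner ℝ (VectorField.mlieBracket (𝓡 m) G V x) (W x)
        - inner ℝ (V x) (VectorField.mlieBracket (𝓡 m) G W x)) x := by
  have : IsContMDiffRiemannianBundle (𝓡 m) 1 (EuclideanSpace ℝ (Fin m))
      (fun x : X => TangentSpace (𝓡 m) x) :=
    IsContMDiffRiemannianBundle.of_le (n := ∞) (by exact_mod_cast le_top)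
  constructor
  · intro f V hf hV
    have h : (fun y : X => inner ℝ ((f • V) y) (W y)) = fun y => f y * inner ℝ (V y) (W y) := by
      funext y
      rw [Pi.smul_apply', real_inner_smul_left]
    rw [h, mvfderiv_fun_mul hf (hV.inner_bundle hW), VectorField.mlieBracket_smul_right hf hV]
    simp [real_inner_smul_left, inner_add_left]
    ring
  · intro V V' hV hV'
    have h : (fun y : X => inner ℝ ((V + V') y) (W y)) =
        fun y => inner ℝ (V y) (W y) + inner ℝ (V' y) (W y) := by
      funext y
      rw [Pi.add_apply, inner_add_left]
    rw [h, mvfderiv_fun_add (hV.inner_bundle hW) (hV'.inner_bundle hW),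
      VectorField.mlieBracket_add_right hV hV']
    simp [inner_add_left]
    ring

variable [RiemannianBundle (fun x : X => TangentSpace (𝓡 m) x)]
  [IsContMDiffRiemannianBundle (𝓡 m) ∞ (EuclideanSpace ℝ (Fin m))
      (fun x : X => TangentSpace (𝓡 m) x)]

/-- `hessAux` extends vectors by a trivialization that changes with the point. Tensoriality allows
one fixed pair of fields instead, as continuity in the point requires. -/
theorem hessAux_eq_of_extension (u : X → ℝ) (x : X) {V W : ∀ y : X, TangentSpace (𝓡 m) y}
    (hV : MDifferentiableAt (𝓡 m) (𝓡 m).tangent (fun y => (⟨y, V y⟩ : TangentBundle (𝓡 m) X)) x)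
    (hW : MDifferentiableAt (𝓡 m) (𝓡 m).tangent (fun y => (⟨y, W y⟩ : TangentBundle (𝓡 m) X)) x) :
    hessAux u x (V x) (W x) =
      (1 / 2) * (mvfderiv (𝓡 m) (fun y => inner ℝ (V y) (W y)) x (grad u x)
        - inner ℝ (VectorField.mlieBracket (𝓡 m) (grad u) V x) (W x)
        - inner ℝ (V x) (VectorField.mlieBracket (𝓡 m) (grad u) W x)) := by
  have hd : ∀ z : TangentSpace (𝓡 m) x, MDifferentiableAt (𝓡 m) (𝓡 m).tangent
      (fun y => (⟨y, FiberBundle.extend (EuclideanSpace ℝ (Fin m)) z y⟩ :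
        TangentBundle (𝓡 m) X)) x :=
    fun z => FiberBundle.mdifferentiableAt_extend (𝓡 m) (EuclideanSpace ℝ (Fin m)) z
  have e1 := TensorialAt.pointwise₂ (I := 𝓡 m) (F := EuclideanSpace ℝ (Fin m))
    (F' := EuclideanSpace ℝ (Fin m)) (x := x)
    (Φ := fun V W : ∀ y : X, TangentSpace (𝓡 m) y =>
        mvfderiv (𝓡 m) (fun y => inner ℝ (V y) (W y)) x (grad u x)
        - inner ℝ (VectorField.mlieBracket (𝓡 m) (grad u) V x) (W x)
        - inner ℝ (V x) (VectorField.mlieBracket (𝓡 m) (grad u) W x))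
    (fun W hW => tensorialAt_koszul_left (grad u) W x hW)
    (fun V hV => by
      have h := tensorialAt_koszul_left (grad u) V x hV
      convert h using 2 with W
      · simp_rw [real_inner_comm]
        ring)
    (hd (V x)) hV (hd (W x)) hW (by simp) (by simp)
  simp only [hessAux]
  rw [← e1]
  simp

end Geometry

/-! ### Regularity of the gradient -/

section Gradient

variable {m : ℕ} {X : Type*} [TopologicalSpace X] [ChartedSpace (EuclideanSpace ℝ (Fin m)) X]
  [IsManifold (𝓡 m) ∞ X]
variable [RiemannianBundle (fun x : X => TangentSpace (𝓡 m) x)]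

theorem inner_grad (u : X → ℝ) (x : X) (v : TangentSpace (𝓡 m) x) :
    inner ℝ (grad u x) v = mvfderiv (𝓡 m) u x v := by
  have : CompleteSpace (TangentSpace (𝓡 m) x) := FiniteDimensional.complete ℝ _
  rw [grad, InnerProductSpace.toDual_symm_apply]

theorem norm_grad (u : X → ℝ) (x : X) : ‖grad (m := m) u x‖ = ‖mvfderiv (𝓡 m) u x‖ := by
  have : CompleteSpace (TangentSpace (𝓡 m) x) := FiniteDimensional.complete ℝ _
  rw [grad, LinearIsometryEquiv.norm_map]

theorem grad_add {u w : X → ℝ} {x : X} (hu : MDifferentiableAt (𝓡 m) 𝓘(ℝ) u x)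
    (hw : MDifferentiableAt (𝓡 m) 𝓘(ℝ) w x) : grad (m := m) (u + w) x = grad u x + grad w x := by
  rw [grad, mvfderiv_add hu hw, map_add]
  rfl

variable [IsContMDiffRiemannianBundle (𝓡 m) ∞ (EuclideanSpace ℝ (Fin m))
      (fun x : X => TangentSpace (𝓡 m) x)]

/-- In a trivialization the gradient is `Γ⁻¹ du`, with `Γ` the Gram operator of the metric. `Γ` is
invertible by positive definiteness, and inversion of operators is smooth. -/
theorem contMDiffAt_grad {u : X → ℝ} {x : X} (hu : ContMDiffAt (𝓡 m) 𝓘(ℝ) 2 u x) :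
    ContMDiffAt (𝓡 m) (𝓡 m).tangent 1
      (fun y => (⟨y, grad u y⟩ : TangentBundle (𝓡 m) X)) x := by
  obtain ⟨g, hg, hgi⟩ := (IsContMDiffRiemannianBundle.of_le (n := ∞) (n' := 1)
      (by exact_mod_cast le_top) : IsContMDiffRiemannianBundle (𝓡 m) 1 (EuclideanSpace ℝ (Fin m))
      (fun x : X => TangentSpace (𝓡 m) x)).exists_contMDiff
  have hg' := ((contMDiffAt_hom_bundle _).1 (hg x)).2
  have hD := hu.mfderiv_const (m := 1) (by norm_num)
  set t := trivializationAt (EuclideanSpace ℝ (Fin m)) (fun y : X => TangentSpace (𝓡 m) y) x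
    with ht
  have hx : x ∈ t.baseSet := FiberBundle.mem_baseSet_trivializationAt' x
  rw [contMDiffAt_totalSpace]
  refine ⟨contMDiffAt_id, ?_⟩
  set Γ : X → EuclideanSpace ℝ (Fin m) →L[ℝ] EuclideanSpace ℝ (Fin m) →L[ℝ] ℝ := fun y =>
    ContinuousLinearMap.inCoordinates (EuclideanSpace ℝ (Fin m))
      (fun y : X => TangentSpace (𝓡 m) y) (EuclideanSpace ℝ (Fin m) →L[ℝ] ℝ)
      (fun y : X => TangentSpace (𝓡 m) y →L[ℝ] ℝ) x y x y (g y) with hΓ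
  have hΓa : ∀ y ∈ t.baseSet, ∀ a b, Γ y a b = inner ℝ (t.symm y a) (t.symm y b) := by
    intro y hy a b
    have h := inCoordinates_apply_eq₂ (E₃ := Bundle.Trivial X ℝ) (F₃ := ℝ) (ϕ := g y) (v := a)
      (w := b) (x₀ := x) hy hy trivial
    rw [hgi]
    refine h.trans ?_
    simp
    rfl
  have hDa : ∀ y ∈ t.baseSet, ∀ b, inTangentCoordinates (𝓡 m) 𝓘(ℝ) id u
      (mfderiv (𝓡 m) 𝓘(ℝ) u) x y b = mvfderiv (𝓡 m) u y (t.symm y b) := by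
    intro y hy b
    simp [inTangentCoordinates, ContinuousLinearMap.inCoordinates]
    change mfderiv (𝓡 m) 𝓘(ℝ) u y (t.symmL ℝ y b) = _
    rw [t.symmL_apply hy]
    rfl
  have hinj : ∀ y ∈ t.baseSet, Function.Injective (Γ y) := by
    intro y hy
    rw [injective_iff_map_eq_zero]
    intro a ha
    have h := hΓa y hy a a
    rw [ha] at h
    have h0 : t.symm y a = 0 := by
      rw [← inner_self_eq_zero (𝕜 := ℝ), ← h]; rfl
    have := t.apply_mk_symm hy a
    rw [h0] at this
    have h2 := congrArg Prod.snd this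
    exact h2.symm.trans (t.linear ℝ hy).map_zero
  have hequiv : ∀ y ∈ t.baseSet, ∃ e : EuclideanSpace ℝ (Fin m) ≃L[ℝ]
      (EuclideanSpace ℝ (Fin m) →L[ℝ] ℝ), (e : _ →L[ℝ] _) = Γ y := by
    intro y hy
    have hfr : Module.finrank ℝ (EuclideanSpace ℝ (Fin m)) =
        Module.finrank ℝ (EuclideanSpace ℝ (Fin m) →L[ℝ] ℝ) := by
      exact (InnerProductSpace.toDual ℝ (EuclideanSpace ℝ (Fin m))).toLinearEquiv.finrank_eq
    refine ⟨(LinearEquiv.ofInjectiveOfFinrankEq (Γ y).toLinearMap (hinj y hy)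
      hfr).toContinuousLinearEquiv, ?_⟩
    ext a b
    rfl
  have key : ∀ y ∈ t.baseSet, (t ⟨y, grad u y⟩).2 =
      (Γ y).inverse (inTangentCoordinates (𝓡 m) 𝓘(ℝ) id u (mfderiv (𝓡 m) 𝓘(ℝ) u) x y) := by
    intro y hy
    obtain ⟨e, he⟩ := hequiv y hy
    rw [← he, ContinuousLinearMap.inverse_equiv]
    rw [ContinuousLinearEquiv.coe_coe, ContinuousLinearEquiv.eq_symm_apply]
    ext b
    have h1 : e (t ⟨y, grad u y⟩).2 b = Γ y (t ⟨y, grad u y⟩).2 b := by rw [← he]; rfl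
    rw [h1, hΓa y hy]
    refine Eq.trans ?_ (hDa y hy b).symm
    rw [t.symm_apply_apply_mk hy, inner_grad]
  obtain ⟨e, he⟩ := hequiv x hx
  have hinv : ContMDiffAt (𝓡 m) 𝓘(ℝ, (EuclideanSpace ℝ (Fin m) →L[ℝ] ℝ) →L[ℝ]
      EuclideanSpace ℝ (Fin m)) 1 (fun y => (Γ y).inverse) x := by
    have h := (contDiffAt_map_inverse (n := 1) e).contMDiffAt
    rw [he] at h
    exact h.comp x hg'
  have hfin := hinv.clm_apply hD
  refine hfin.congr_of_eventuallyEq ?_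
  filter_upwards [t.open_baseSet.mem_nhds hx] with y hy
  exact key y hy

end Gradient

/-! ### Continuity and additivity of 2-jets -/

section Hessian

variable {m : ℕ} {X : Type*} [TopologicalSpace X] [ChartedSpace (EuclideanSpace ℝ (Fin m)) X]
  [IsManifold (𝓡 m) ∞ X]

variable (m) in
/-- The local vector field near `x` which is constant in the trivialization of `TX` at `x`. -/
noncomputable def coordField (x : X) (a : EuclideanSpace ℝ (Fin m)) (y : X) :
    TangentSpace (𝓡 m) y :=
  (trivializationAt (EuclideanSpace ℝ (Fin m)) (fun y : X => TangentSpace (𝓡 m) y) x).symm y a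

theorem contMDiffAt_coordField (x : X) (a : EuclideanSpace ℝ (Fin m)) {k : WithTop ℕ∞}
    (hk : k + 1 ≤ ∞) :
    ContMDiffAt (𝓡 m) (𝓡 m).tangent k
      (fun y => (⟨y, coordField m x a y⟩ : TangentBundle (𝓡 m) X)) x := by
  set t := trivializationAt (EuclideanSpace ℝ (Fin m)) (fun y : X => TangentSpace (𝓡 m) y) x
    with ht
  have hx : x ∈ t.baseSet := FiberBundle.mem_baseSet_trivializationAt' x
  have h : coordField m x a = FiberBundle.extend (EuclideanSpace ℝ (Fin m)) (t.symm x a) := by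
    funext y
    simp only [coordField, FiberBundle.extend, ← ht]
    rw [t.apply_mk_symm hx]
  have : IsManifold (𝓡 m) (k + 1) X := IsManifold.of_le hk
  have : ContMDiffVectorBundle k (EuclideanSpace ℝ (Fin m))
    (TangentSpace (𝓡 m) : X → Type) (𝓡 m) := TangentBundle.contMDiffVectorBundle (n := k)
  rw [h]
  exact FiberBundle.contMDiffAt_extend (𝓡 m) (EuclideanSpace ℝ (Fin m)) _

theorem continuousAt_mvfderiv {u : X → ℝ} {x : X} (hu : ContMDiffAt (𝓡 m) 𝓘(ℝ) 2 u x) :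
    ContinuousAt (fun y => (⟨y, mvfderiv (𝓡 m) u y⟩ :
      TotalSpace (EuclideanSpace ℝ (Fin m) →L[ℝ] ℝ)
        (fun x : X => TangentSpace (𝓡 m) x →L[ℝ] ℝ))) x := by
  have hx := FiberBundle.mem_baseSet_trivializationAt' (F := EuclideanSpace ℝ (Fin m))
    (E := fun y : X => TangentSpace (𝓡 m) y) x
  refine (continuousAt_hom_bundle (RingHom.id ℝ) _).2 ⟨continuousAt_id, ?_⟩
  rw [continuousAt_clm_apply]
  intro b
  refine ContinuousAt.congr
    (contMDiffAt_mvfderiv_apply hu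
      (contMDiffAt_coordField x b (k := 1) (by norm_cast))).continuousAt ?_
  filter_upwards [(Bundle.Trivialization.open_baseSet _).mem_nhds hx] with y hy
  simp only [ContinuousLinearMap.inCoordinates, ContinuousLinearMap.comp_apply,
    Trivialization.symmL_apply _ hy]
  simp
  rfl

variable [RiemannianBundle (fun x : X => TangentSpace (𝓡 m) x)]
  [IsContMDiffRiemannianBundle (𝓡 m) ∞ (EuclideanSpace ℝ (Fin m))
      (fun x : X => TangentSpace (𝓡 m) x)]

theorem continuousAt_hessAux_coordField {u : X → ℝ} {x : X}
    (hu : ContMDiffAt (𝓡 m) 𝓘(ℝ) 2 u x) (a b : EuclideanSpace ℝ (Fin m)) :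
    ContinuousAt (fun y => hessAux u y (coordField m x a y) (coordField m x b y)) x := by
  have h2 : (2 : WithTop ℕ∞) ≤ ∞ := by norm_cast
  have : IsManifold (𝓡 m) (minSmoothness ℝ 2) X := IsManifold.of_le (n := ∞) (by simpa using h2)
  have : IsManifold (𝓡 m) ((1 : ℕ∞) + 1) X := IsManifold.of_le (n := ∞) (by norm_cast)
  have hR2 : IsContMDiffRiemannianBundle (𝓡 m) 2 (EuclideanSpace ℝ (Fin m))
      (fun x : X => TangentSpace (𝓡 m) x) :=
    IsContMDiffRiemannianBundle.of_le (n := ∞) h2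
  have hR0 : IsContMDiffRiemannianBundle (𝓡 m) ((0 : ℕ∞) : WithTop ℕ∞) (EuclideanSpace ℝ (Fin m))
      (fun x : X => TangentSpace (𝓡 m) x) :=
    IsContMDiffRiemannianBundle.of_le (n := ∞) (by norm_cast)
  have hev : ∀ c, ∀ᶠ y in 𝓝 x, MDifferentiableAt (𝓡 m) (𝓡 m).tangent
      (fun y => (⟨y, coordField m x c y⟩ : TangentBundle (𝓡 m) X)) y := by
    intro c
    filter_upwards [contMDiffAt_iff_contMDiffAt_nhds (by simp) |>.1
      (contMDiffAt_coordField x c (k := 1) (by norm_cast))] with y hy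
    exact hy.mdifferentiableAt (by simp)
  have hG := contMDiffAt_grad hu
  have hbr : ∀ c, ContMDiffAt (𝓡 m) (𝓡 m).tangent ((0 : ℕ∞) : WithTop ℕ∞) (fun y => (⟨y,
      VectorField.mlieBracket (𝓡 m) (grad u) (coordField m x c) y⟩ : TangentBundle (𝓡 m) X)) x :=
    fun c => ContMDiffAt.mlieBracket_vectorField (m := 0) (n := 1) hG
      (contMDiffAt_coordField x c (k := 1) (by norm_cast)) (by simp)
  have h1 : ContinuousAt (fun y => mvfderiv (𝓡 m) (fun y => inner ℝ (coordField m x a y)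
      (coordField m x b y)) y (grad u y)) x :=
    (contMDiffAt_mvfderiv_apply ((contMDiffAt_coordField x a (k := 2) (by norm_cast)).inner_bundle
      (contMDiffAt_coordField x b (k := 2) (by norm_cast))) hG).continuousAt
  have h2 := ((hbr a).inner_bundle (contMDiffAt_coordField x b
    (k := ((0 : ℕ∞) : WithTop ℕ∞)) (by norm_cast))).continuousAt
  have h3 := ((contMDiffAt_coordField x a
    (k := ((0 : ℕ∞) : WithTop ℕ∞)) (by norm_cast)).inner_bundle (hbr b)).continuousAt
  refine ContinuousAt.congr ((continuousAt_const (y := (1 / 2 : ℝ))).mul ((h1.sub h2).sub h3)) ?_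
  filter_upwards [hev a, hev b] with y hya hyb
  exact (hessAux_eq_of_extension u y hya hyb).symm

theorem hess_inCoordinates (u : X → ℝ) {x y : X} (hy : y ∈ (trivializationAt
    (EuclideanSpace ℝ (Fin m)) (fun y : X => TangentSpace (𝓡 m) y) x).baseSet)
    (a b : EuclideanSpace ℝ (Fin m)) :
    ContinuousLinearMap.inCoordinates (EuclideanSpace ℝ (Fin m))
      (fun y : X => TangentSpace (𝓡 m) y) (EuclideanSpace ℝ (Fin m) →L[ℝ] ℝ)
      (fun y : X => TangentSpace (𝓡 m) y →L[ℝ] ℝ) x y x y (hess u y).1 a b =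
    hessAux u y (coordField m x a y) (coordField m x b y) := by
  have h := inCoordinates_apply_eq₂ (E₃ := Bundle.Trivial X ℝ) (F₃ := ℝ) (ϕ := (hess u y).1)
    (v := a) (w := b) (x₀ := x) hy hy trivial
  refine h.trans ?_
  simp
  rfl

theorem continuousAt_hess_inCoordinates {u : X → ℝ} {x : X}
    (hu : ContMDiffAt (𝓡 m) 𝓘(ℝ) 2 u x) :
    ContinuousAt (fun y => ContinuousLinearMap.inCoordinates (EuclideanSpace ℝ (Fin m))
      (fun y : X => TangentSpace (𝓡 m) y) (EuclideanSpace ℝ (Fin m) →L[ℝ] ℝ)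
      (fun y : X => TangentSpace (𝓡 m) y →L[ℝ] ℝ) x y x y (hess u y).1) x := by
  have hx := FiberBundle.mem_baseSet_trivializationAt' (F := EuclideanSpace ℝ (Fin m))
    (E := fun y : X => TangentSpace (𝓡 m) y) x
  rw [continuousAt_clm_apply]
  intro a
  rw [continuousAt_clm_apply]
  intro b
  refine ContinuousAt.congr (continuousAt_hessAux_coordField hu a b) ?_
  filter_upwards [(Bundle.Trivialization.open_baseSet _).mem_nhds hx] with y hy
  exact (hess_inCoordinates u hy a b).symm

theorem continuousAt_jetOf {u : X → ℝ} {x : X} (hu : ContMDiffAt (𝓡 m) 𝓘(ℝ) 2 u x) :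
    ContinuousAt (fun y => (jetOf u y : Jet2 m X)) x := by
  rw [(Topology.IsInducing.mk rfl : Topology.IsInducing
    (Jet2.components (m := m) (X := X))).continuousAt_iff]
  refine ContinuousAt.prodMk hu.continuousAt
    ((continuousAt_mvfderiv hu).prodMk
      ((continuousAt_hom_bundle (RingHom.id ℝ) _).2 ⟨continuousAt_id, ?_⟩))
  exact continuousAt_hess_inCoordinates hu

theorem hess_add {u w : X → ℝ} {x : X} (hu : ContMDiffAt (𝓡 m) 𝓘(ℝ) 2 u x)
    (hw : ContMDiffAt (𝓡 m) 𝓘(ℝ) 2 w x) :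
    hess (m := m) (u + w) x = hess u x + hess w x := by
  have he : (grad (m := m) (u + w)) =ᶠ[𝓝 x] grad u + grad w := by
    filter_upwards [contMDiffAt_iff_contMDiffAt_nhds (by simp) |>.1 hu,
      contMDiffAt_iff_contMDiffAt_nhds (by simp) |>.1 hw] with y h1 h2
    exact grad_add (h1.mdifferentiableAt (by simp)) (h2.mdifferentiableAt (by simp))
  have hb : ∀ V : ∀ y : X, TangentSpace (𝓡 m) y, VectorField.mlieBracket (𝓡 m) (grad (u + w)) V x =
      VectorField.mlieBracket (𝓡 m) (grad u) V x + VectorField.mlieBracket (𝓡 m) (grad w) V x := by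
    intro V
    rw [← VectorField.mlieBracket_add_left ((contMDiffAt_grad hu).mdifferentiableAt (by simp))
      ((contMDiffAt_grad hw).mdifferentiableAt (by simp))]
    exact Filter.EventuallyEq.mlieBracket_vectorField_eq he (Filter.EventuallyEq.refl _ _)
  apply Subtype.ext
  ext v v'
  change hessAux (u + w) x v v' = hessAux u x v v' + hessAux w x v v'
  simp only [hessAux]
  rw [hb, hb, grad_add (hu.mdifferentiableAt (by simp)) (hw.mdifferentiableAt (by simp)), map_add]
  simp only [inner_add_left, inner_add_right]
  ring

theorem jetOf_add {u w : X → ℝ} {x : X} (hu : ContMDiffAt (𝓡 m) 𝓘(ℝ) 2 u x)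
    (hw : ContMDiffAt (𝓡 m) 𝓘(ℝ) 2 w x) :
    jetOf (m := m) (u + w) x = ⟨x, (jetOf u x).jet + (jetOf w x).jet⟩ := by
  simp only [jetOf, hess_add hu hw,
    mvfderiv_add (hu.mdifferentiableAt (by simp)) (hw.mdifferentiableAt (by simp))]
  rfl

theorem grad_const (c : ℝ) : grad (m := m) (fun _ : X => c) = 0 := by
  funext x
  rw [grad, mvfderiv_const, map_zero]
  rfl

theorem hess_const (c : ℝ) (x : X) : hess (m := m) (fun _ : X => c) x = 0 := by
  apply Subtype.ext
  ext v v'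
  change hessAux (fun _ => c) x v v' = 0
  simp only [hessAux]
  rw [grad_const]
  simp

theorem jetOf_const (c : ℝ) (x : X) :
    jetOf (m := m) (fun _ : X => c) x = ⟨x, (c, 0, 0)⟩ := by
  simp only [jetOf, hess_const, mvfderiv_const]

end Hessian

/-! ### The Hessian at a critical point -/

section CriticalPoint

variable {m : ℕ} {X : Type*} [TopologicalSpace X] [ChartedSpace (EuclideanSpace ℝ (Fin m)) X]
  [IsManifold (𝓡 m) ∞ X]

/-- The fields `coordField` are the coordinate fields of the chart at `x`. -/
theorem mvfderiv_coordField {f : X → ℝ} {x y : X}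
    (hy : y ∈ (chartAt (EuclideanSpace ℝ (Fin m)) x).source)
    (hf : MDifferentiableAt (𝓡 m) 𝓘(ℝ) f y) (a : EuclideanSpace ℝ (Fin m)) :
    mvfderiv (𝓡 m) f y (coordField m x a y) =
      fderiv ℝ (f ∘ (extChartAt (𝓡 m) x).symm) (extChartAt (𝓡 m) x y) a := by
  have hy' : y ∈ (trivializationAt (EuclideanSpace ℝ (Fin m))
      (fun y : X => TangentSpace (𝓡 m) y) x).baseSet := by simpa using hy
  have hys : y ∈ (extChartAt (𝓡 m) x).source := by simpa using hy
  have hs : MDifferentiableWithinAt 𝓘(ℝ, EuclideanSpace ℝ (Fin m)) (𝓡 m)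
      (extChartAt (𝓡 m) x).symm (Set.range (𝓡 m)) (extChartAt (𝓡 m) x y) :=
    mdifferentiableWithinAt_extChartAt_symm ((extChartAt (𝓡 m) x).map_source hys)
  have hs' : MDifferentiableAt 𝓘(ℝ, EuclideanSpace ℝ (Fin m)) (𝓡 m)
      (extChartAt (𝓡 m) x).symm (extChartAt (𝓡 m) x y) := by
    simpa [mdifferentiableWithinAt_univ] using hs
  have hinv := (extChartAt (𝓡 m) x).left_inv hys
  have h1 : coordField m x a y =
      mfderiv 𝓘(ℝ, EuclideanSpace ℝ (Fin m)) (𝓡 m) (extChartAt (𝓡 m) x).symm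
        (extChartAt (𝓡 m) x y) a := by
    rw [coordField, ← Trivialization.symmL_apply (R := ℝ) _ hy',
      TangentBundle.symmL_trivializationAt hy,
      show Set.range (𝓡 m) = Set.univ from ModelWithCorners.range_eq_univ _, mfderivWithin_univ]
    rfl
  have h2 := mfderiv_comp_of_eq (I := 𝓘(ℝ, EuclideanSpace ℝ (Fin m))) (I' := 𝓡 m) (I'' := 𝓘(ℝ))
    (x := extChartAt (𝓡 m) x y) (f := (extChartAt (𝓡 m) x).symm) (g := f) (y := y) hf hs' hinv
  rw [mfderiv_eq_fderiv] at h2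
  have h3 : ∀ y' : X, y' = y → ∀ w : EuclideanSpace ℝ (Fin m),
      (mfderiv (𝓡 m) 𝓘(ℝ) f y' w : ℝ) = mvfderiv (𝓡 m) f y w := by
    rintro _ rfl w
    rfl
  rw [h2, h1]
  exact (h3 _ hinv _).symm

theorem coordField_self (x : X) (v : EuclideanSpace ℝ (Fin m)) : coordField m x v x = v := by
  have hx : x ∈ (trivializationAt (EuclideanSpace ℝ (Fin m))
      (fun y : X => TangentSpace (𝓡 m) y) x).baseSet := FiberBundle.mem_baseSet_trivializationAt' x
  rw [coordField, ← Trivialization.symmL_apply (R := ℝ) _ hx,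
      TangentBundle.symmL_trivializationAt (mem_chart_source (EuclideanSpace ℝ (Fin m)) x),
      mfderivWithin_range_extChartAt_symm]
  rfl

theorem mvfderiv_eq_fderiv_extChartAt {f : X → ℝ} {x : X}
    (hf : MDifferentiableAt (𝓡 m) 𝓘(ℝ) f x) (v : EuclideanSpace ℝ (Fin m)) :
    mvfderiv (𝓡 m) f x v =
      fderiv ℝ (f ∘ (extChartAt (𝓡 m) x).symm) (extChartAt (𝓡 m) x x) v := by
  have h := mvfderiv_coordField (mem_chart_source (EuclideanSpace ℝ (Fin m)) x) hf v
  rwa [coordField_self] at h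

variable [RiemannianBundle (fun x : X => TangentSpace (𝓡 m) x)]
  [IsContMDiffRiemannianBundle (𝓡 m) ∞ (EuclideanSpace ℝ (Fin m))
      (fun x : X => TangentSpace (𝓡 m) x)]

/-- The difference of the two sides is tensorial in `G`, because the terms `(V f)⟨G, W⟩` cancel. It
therefore depends only on `G x`, and vanishes when `G x = 0`. -/
theorem inner_mlieBracket_of_eq_zero {G V W : ∀ y : X, TangentSpace (𝓡 m) y} {x : X}
    (hG : MDifferentiableAt (𝓡 m) (𝓡 m).tangent (fun y => (⟨y, G y⟩ : TangentBundle (𝓡 m) X)) x)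
    (hW : MDifferentiableAt (𝓡 m) (𝓡 m).tangent (fun y => (⟨y, W y⟩ : TangentBundle (𝓡 m) X)) x)
    (h0 : G x = 0) :
    inner ℝ (VectorField.mlieBracket (𝓡 m) G V x) (W x) =
      - mvfderiv (𝓡 m) (fun y => inner ℝ (G y) (W y)) x (V x) := by
  have : IsContMDiffRiemannianBundle (𝓡 m) 1 (EuclideanSpace ℝ (Fin m))
      (fun x : X => TangentSpace (𝓡 m) x) :=
    IsContMDiffRiemannianBundle.of_le (n := ∞) (by exact_mod_cast le_top)
  have hT : TensorialAt (𝓡 m) (EuclideanSpace ℝ (Fin m))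
      (fun G : ∀ y : X, TangentSpace (𝓡 m) y =>
        inner ℝ (VectorField.mlieBracket (𝓡 m) G V x) (W x) +
          mvfderiv (𝓡 m) (fun y => inner ℝ (G y) (W y)) x (V x)) x := by
    constructor
    · intro f G hf hG
      have h : (fun y : X => inner ℝ ((f • G) y) (W y)) = fun y => f y * inner ℝ (G y) (W y) := by
        funext y
        rw [Pi.smul_apply', real_inner_smul_left]
      rw [h, mvfderiv_fun_mul hf (hG.inner_bundle hW), VectorField.mlieBracket_smul_left hf hG]
      simp [real_inner_smul_left, inner_add_left]
      ring
    · intro G G' hG hG'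
      have h : (fun y : X => inner ℝ ((G + G') y) (W y)) =
          fun y => inner ℝ (G y) (W y) + inner ℝ (G' y) (W y) := by
        funext y
        rw [Pi.add_apply, inner_add_left]
      rw [h, mvfderiv_fun_add (hG.inner_bundle hW) (hG'.inner_bundle hW),
        VectorField.mlieBracket_add_left hG hG']
      simp [inner_add_left]
      ring
  have h := hT.pointwise hG (mdifferentiable_zeroSection ..) (σ' := 0) h0
  rw [hT.zero] at h
  linarith

/-- With `G = grad f` zero at `x`, each of the two bracket terms of Koszul's formula contributes `V
(V f)` and the metric term vanishes. No Christoffel symbols remain, so the chart's second derivative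
is the Hessian. -/
theorem hess_self_of_critical {f : X → ℝ} {x : X} (hf : ContMDiffAt (𝓡 m) 𝓘(ℝ) 2 f x)
    (h0 : mvfderiv (𝓡 m) f x = 0) (v : EuclideanSpace ℝ (Fin m)) :
    (hess f x).1 v v =
      fderiv ℝ (fun z => fderiv ℝ (f ∘ (extChartAt (𝓡 m) x).symm) z v)
        (extChartAt (𝓡 m) x x) v := by
  have hV1 := contMDiffAt_coordField (m := m) x v (k := 1) (by norm_cast)
  have hV := hV1.mdifferentiableAt (by simp)
  have hgrad : grad (m := m) f x = 0 := by rw [grad, h0, map_zero]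
  have hxc := mem_chart_source (EuclideanSpace ℝ (Fin m)) x
  have h : hessAux f x (coordField m x v x) (coordField m x v x) = (hess f x).1 v v := by
    rw [coordField_self x v]
    rfl
  refine h.symm.trans ?_
  rw [hessAux_eq_of_extension f x hV hV, real_inner_comm _ (coordField m x v x),
    inner_mlieBracket_of_eq_zero ((contMDiffAt_grad hf).mdifferentiableAt (by simp)) hV hgrad,
    hgrad, map_zero]
  have e1 : (fun y => inner ℝ (grad f y) (coordField m x v y)) =
      fun y => mvfderiv (𝓡 m) f y (coordField m x v y) := by
    funext y
    exact inner_grad f y _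
  rw [e1, mvfderiv_coordField hxc ((contMDiffAt_mvfderiv_apply hf hV1).mdifferentiableAt (by simp))]
  have e2 : (fun y => mvfderiv (𝓡 m) f y (coordField m x v y)) ∘ (extChartAt (𝓡 m) x).symm
      =ᶠ[𝓝 (extChartAt (𝓡 m) x x)] fun z => fderiv ℝ (f ∘ (extChartAt (𝓡 m) x).symm) z v := by
    have h1 := contMDiffAt_iff_contMDiffAt_nhds (by simp) |>.1 hf
    have h2 : ∀ᶠ y in 𝓝 x, y ∈ (chartAt (EuclideanSpace ℝ (Fin m)) x).source :=
      (chartAt (EuclideanSpace ℝ (Fin m)) x).open_source.mem_nhds hxc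
    have hc := continuousAt_extChartAt_symm (I := 𝓡 m) x
    rw [ContinuousAt, (extChartAt (𝓡 m) x).left_inv (mem_extChartAt_source x)] at hc
    filter_upwards [hc.eventually h1, hc.eventually h2, extChartAt_target_mem_nhds (I := 𝓡 m) x]
      with z hz1 hz2 hz3
    simp only [Function.comp_apply]
    rw [mvfderiv_coordField hz2 (hz1.mdifferentiableAt (by simp)),
      (extChartAt (𝓡 m) x).right_inv hz3]
  rw [e2.fderiv_eq]
  ring

end CriticalPoint

/-! ### Second derivative test -/

/-- A negative second derivative would make `t` a local maximum too, so `q` would be constant near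
`t` and the second derivative zero. -/
theorem deriv_deriv_nonneg_of_isLocalMin {q : ℝ → ℝ} {t : ℝ} (h : IsLocalMin q t)
    (hc : ContinuousAt q t) : 0 ≤ deriv (deriv q) t := by
  by_contra! hneg
  have hmax := isLocalMax_of_deriv_deriv_neg hneg h.deriv_eq_zero hc
  have heq : q =ᶠ[𝓝 t] fun _ => q t := by
    filter_upwards [h, hmax] with s h1 h2
    exact le_antisymm h2 h1
  have h2 : deriv q =ᶠ[𝓝 t] fun _ => 0 := by
    filter_upwards [heq.eventuallyEq_nhds] with s hs
    rw [hs.deriv_eq, deriv_const]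
  rw [h2.deriv_eq, deriv_const] at hneg
  exact lt_irrefl _ hneg

theorem fderiv_fderiv_nonneg_of_isLocalMin {E : Type*} [NormedAddCommGroup E] [NormedSpace ℝ E]
    {f : E → ℝ} {p : E} (h : IsLocalMin f p) (hf : ContDiffAt ℝ 2 f p) (v : E) :
    0 ≤ fderiv ℝ (fun z => fderiv ℝ f z v) p v := by
  have hline : ∀ s : ℝ, HasDerivAt (fun t : ℝ => p + t • v) v s := by
    intro s
    simpa using ((hasDerivAt_id s).smul_const v).const_add p
  have hp : p + (0 : ℝ) • v = p := by simp
  have hcont : ContinuousAt (fun t : ℝ => p + t • v) 0 := (hline 0).continuousAt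
  have htend : Filter.Tendsto (fun t : ℝ => p + t • v) (𝓝 0) (𝓝 p) := by
    have := hcont.tendsto
    rwa [hp] at this
  have hmin : IsLocalMin (fun t : ℝ => f (p + t • v)) 0 := by
    have := htend.eventually h
    filter_upwards [this] with t ht
    simpa using ht
  have hd1 : deriv (fun t : ℝ => f (p + t • v)) =ᶠ[𝓝 0] fun t => fderiv ℝ f (p + t • v) v := by
    filter_upwards [htend.eventually (hf.eventually (by simp))] with t ht
    exact ((ht.differentiableAt (by simp)).hasFDerivAt.comp_hasDerivAt t (hline t)).deriv
  have hd2 : DifferentiableAt ℝ (fun z => fderiv ℝ f z v) p := by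
    have h1 : ContDiffAt ℝ 1 (fderiv ℝ f) p := hf.fderiv_right (by norm_num)
    exact (h1.differentiableAt (by simp)).clm_apply (differentiableAt_const v)
  have hd3 : deriv (fun t : ℝ => fderiv ℝ f (p + t • v) v) 0 =
      fderiv ℝ (fun z => fderiv ℝ f z v) p v := by
    have := hd2.hasFDerivAt.comp_hasDerivAt_of_eq (0 : ℝ) (hline 0) hp.symm
    exact this.deriv
  rw [← hd3, ← hd1.deriv_eq]
  refine deriv_deriv_nonneg_of_isLocalMin hmin ?_
  exact ContinuousAt.comp_of_eq hf.continuousAt hcont hp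

/-! ### Functions with prescribed jets, and jets at local minima -/

section LocalFunctions

variable {m : ℕ} {X : Type*} [TopologicalSpace X] [ChartedSpace (EuclideanSpace ℝ (Fin m)) X]
  [IsManifold (𝓡 m) ∞ X]

theorem contDiffAt_comp_extChartAt_symm {f : X → ℝ} {x : X}
    (hf : ContMDiffAt (𝓡 m) 𝓘(ℝ) 2 f x) :
    ContDiffAt ℝ 2 (f ∘ (extChartAt (𝓡 m) x).symm) (extChartAt (𝓡 m) x x) := by
  have h := (contMDiffAt_iff.1 hf).2
  rw [show Set.range (𝓡 m) = Set.univ from ModelWithCorners.range_eq_univ _,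
    contDiffWithinAt_univ] at h
  exact h

theorem contMDiffAt_comp_extChartAt {q : EuclideanSpace ℝ (Fin m) → ℝ} (hq : ContDiff ℝ 2 q)
    (x : X) : ContMDiffAt (𝓡 m) 𝓘(ℝ) 2 (q ∘ extChartAt (𝓡 m) x) x := by
  have : IsManifold (𝓡 m) 2 X := IsManifold.of_le (n := ∞) (by norm_cast)
  exact hq.contMDiff.contMDiffAt.comp x (contMDiffAt_extChartAt (n := 2))

theorem comp_extChartAt_comp_symm (q : EuclideanSpace ℝ (Fin m) → ℝ) (x : X) :
    (q ∘ extChartAt (𝓡 m) x) ∘ (extChartAt (𝓡 m) x).symm =ᶠ[𝓝 (extChartAt (𝓡 m) x x)] q := by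
  filter_upwards [extChartAt_target_mem_nhds (I := 𝓡 m) x] with z hz
  simp only [Function.comp_apply]
  rw [(extChartAt (𝓡 m) x).right_inv hz]

theorem mvfderiv_comp_extChartAt {q : EuclideanSpace ℝ (Fin m) → ℝ} (hq : ContDiff ℝ 2 q)
    (x : X) (v : EuclideanSpace ℝ (Fin m)) :
    mvfderiv (𝓡 m) (q ∘ extChartAt (𝓡 m) x) x v = fderiv ℝ q (extChartAt (𝓡 m) x x) v := by
  rw [← (comp_extChartAt_comp_symm q x).fderiv_eq]
  exact mvfderiv_eq_fderiv_extChartAt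
    ((contMDiffAt_comp_extChartAt hq x).mdifferentiableAt (by simp)) v

theorem mvfderiv_eq_zero_of_isLocalMin {f : X → ℝ} {x : X} (h : IsLocalMin f x)
    (hf : MDifferentiableAt (𝓡 m) 𝓘(ℝ) f x) : mvfderiv (𝓡 m) f x = 0 := by
  have hc := continuousAt_extChartAt_symm (I := 𝓡 m) x
  rw [ContinuousAt, (extChartAt (𝓡 m) x).left_inv (mem_extChartAt_source x)] at hc
  have hmin : IsLocalMin (f ∘ (extChartAt (𝓡 m) x).symm) (extChartAt (𝓡 m) x x) := by
    filter_upwards [hc.eventually h] with z hz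
    simp only [Function.comp_apply]
    rwa [(extChartAt (𝓡 m) x).left_inv (mem_extChartAt_source x)]
  ext v
  refine (mvfderiv_eq_fderiv_extChartAt hf v).trans ?_
  rw [hmin.fderiv_eq_zero]
  rfl

/-- There is a function that is `C²` at `x`, vanishes at `x` and is positive at the other points
near `x`. -/
theorem exists_contMDiffAt_pos_of_ne (x : X) : ∃ ρ : X → ℝ, ContMDiffAt (𝓡 m) 𝓘(ℝ) 2 ρ x ∧ ρ x = 0 ∧
    ∀ᶠ y in 𝓝 x, y ≠ x → 0 < ρ y := by
  refine ⟨(fun z => ‖z - extChartAt (𝓡 m) x x‖ ^ 2) ∘ extChartAt (𝓡 m) x,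
    contMDiffAt_comp_extChartAt ((contDiff_id.sub contDiff_const).norm_sq ℝ) x, by simp, ?_⟩
  filter_upwards [extChartAt_source_mem_nhds (I := 𝓡 m) x] with y hy hne
  have : extChartAt (𝓡 m) x y ≠ extChartAt (𝓡 m) x x := fun h =>
    hne ((extChartAt (𝓡 m) x).injOn hy (mem_extChartAt_source x) h)
  have := norm_pos_iff.2 (sub_ne_zero.2 this)
  simp only [Function.comp_apply]
  positivity

variable [RiemannianBundle (fun x : X => TangentSpace (𝓡 m) x)]
  [IsContMDiffRiemannianBundle (𝓡 m) ∞ (EuclideanSpace ℝ (Fin m))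
      (fun x : X => TangentSpace (𝓡 m) x)]

theorem hess_nonneg_of_isLocalMin {f : X → ℝ} {x : X} (h : IsLocalMin f x)
    (hf : ContMDiffAt (𝓡 m) 𝓘(ℝ) 2 f x) (v : TangentSpace (𝓡 m) x) : 0 ≤ (hess f x).1 v v := by
  have hc := continuousAt_extChartAt_symm (I := 𝓡 m) x
  rw [ContinuousAt, (extChartAt (𝓡 m) x).left_inv (mem_extChartAt_source x)] at hc
  have hmin : IsLocalMin (f ∘ (extChartAt (𝓡 m) x).symm) (extChartAt (𝓡 m) x x) := by
    filter_upwards [hc.eventually h] with z hz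
    simp only [Function.comp_apply]
    rwa [(extChartAt (𝓡 m) x).left_inv (mem_extChartAt_source x)]
  have hz := mvfderiv_eq_zero_of_isLocalMin h (hf.mdifferentiableAt (by simp))
  refine le_of_le_of_eq ?_ (hess_self_of_critical hf hz v).symm
  exact fderiv_fderiv_nonneg_of_isLocalMin hmin (contDiffAt_comp_extChartAt_symm hf) v

theorem symForm_ext_of_self {x : X} {A B : SymForm (m := m) x} (h : ∀ v, A.1 v v = B.1 v v) :
    A = B := by
  apply Subtype.ext
  ext v w
  have h1 := h (v + w)
  simp only [map_add, add_apply] at h1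
  have h2 := A.2 v w
  have h3 := B.2 v w
  have h4 := h v
  have h5 := h w
  linarith

/-- An affine function in the chart realizes `(r, p)`, but its covariant Hessian need not vanish. A
quadratic term, critical at `x`, corrects it without changing value or differential. -/
theorem exists_jetOf_eq (x : X) (j : JetFiber (m := m) x) :
    ∃ ψ : X → ℝ, ContMDiffAt (𝓡 m) 𝓘(ℝ) 2 ψ x ∧ jetOf ψ x = ⟨x, j⟩ := by
  obtain ⟨r, p, A⟩ := j
  set z0 := extChartAt (𝓡 m) x x with hz0
  let L : EuclideanSpace ℝ (Fin m) →L[ℝ] ℝ := p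
  let f1 : X → ℝ := (fun z => r + L (z - z0)) ∘ extChartAt (𝓡 m) x
  have hq1 : ContDiff ℝ 2 (fun z => r + L (z - z0)) := by fun_prop
  have hf1 : ContMDiffAt (𝓡 m) 𝓘(ℝ) 2 f1 x := contMDiffAt_comp_extChartAt hq1 x
  let B : EuclideanSpace ℝ (Fin m) →L[ℝ] EuclideanSpace ℝ (Fin m) →L[ℝ] ℝ := (A - hess f1 x).1
  let q2 : EuclideanSpace ℝ (Fin m) → ℝ := fun z => (1 / 2) * B (z - z0) (z - z0)
  have hq2 : ContDiff ℝ 2 q2 := by fun_prop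
  have hf2 : ContMDiffAt (𝓡 m) 𝓘(ℝ) 2 (q2 ∘ extChartAt (𝓡 m) x) x :=
    contMDiffAt_comp_extChartAt hq2 x
  have hB : ∀ v w, B v w = B w v := (A - hess f1 x).2
  have hd2 : ∀ z v, fderiv ℝ q2 z v = B (z - z0) v := by
    intro z v
    have h1 : HasFDerivAt (fun z => z - z0) (ContinuousLinearMap.id ℝ _) z :=
      (hasFDerivAt_id z).sub_const z0
    have h2 := ((B.hasFDerivAt.comp z h1).clm_apply h1).const_mul (1 / 2 : ℝ)
    have h3 : fderiv ℝ q2 z = _ := h2.fderiv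
    rw [h3]
    change (1 / 2 : ℝ) * (B (z - z0) v + B v (z - z0)) = _
    rw [hB v]
    ring
  have hcrit : mvfderiv (𝓡 m) (q2 ∘ extChartAt (𝓡 m) x) x = 0 := by
    ext v
    refine (mvfderiv_comp_extChartAt hq2 x v).trans ((hd2 _ v).trans ?_)
    rw [← hz0, sub_self, map_zero]
    rfl
  have hhess : hess (q2 ∘ extChartAt (𝓡 m) x) x = A - hess f1 x := by
    apply symForm_ext_of_self
    intro (v : EuclideanSpace ℝ (Fin m))
    refine (hess_self_of_critical hf2 hcrit v).trans ?_
    have e2 : (fun z => fderiv ℝ ((q2 ∘ extChartAt (𝓡 m) x) ∘ (extChartAt (𝓡 m) x).symm) z v)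
        =ᶠ[𝓝 (extChartAt (𝓡 m) x x)] fun z => B (z - z0) v := by
      filter_upwards [(comp_extChartAt_comp_symm q2 x).eventuallyEq_nhds] with z hz
      rw [hz.fderiv_eq, hd2]
    rw [e2.fderiv_eq]
    have h1 : HasFDerivAt (fun z => z - z0) (ContinuousLinearMap.id ℝ _) z0 :=
      (hasFDerivAt_id z0).sub_const z0
    have h2 := (B.hasFDerivAt.comp z0 h1).clm_apply (hasFDerivAt_const v z0)
    have h3 : fderiv ℝ (fun z => B (z - z0) v) z0 = _ := h2.fderiv
    rw [h3]
    simp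
    rfl
  refine ⟨f1 + q2 ∘ extChartAt (𝓡 m) x, hf1.add hf2, ?_⟩
  rw [jetOf_add hf1 hf2]
  have e1 : f1 x = r := by simp [f1, hz0]
  have e2 : (q2 ∘ extChartAt (𝓡 m) x) x = 0 := by simp [q2, hz0]
  have e3 : mvfderiv (𝓡 m) f1 x = p := by
    ext v
    refine (mvfderiv_comp_extChartAt hq1 x v).trans ?_
    have h1 : HasFDerivAt (fun z => r + L (z - z0)) L z0 := by
      have := (L.hasFDerivAt.comp z0 ((hasFDerivAt_id z0).sub_const z0)).const_add r
      simpa using! this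
    rw [← hz0, h1.fderiv]
    rfl
  simp only [jetOf, e1, e2, e3, hcrit, hhess]
  congr 1
  refine Prod.ext (add_zero r) (Prod.ext (add_zero p) (add_sub_cancel _ A))

end LocalFunctions

/-! ### The metric norm on jets -/

theorem norm_smul_dual {V : Type*} [NormedAddCommGroup V] [InnerProductSpace ℝ V] (c : ℝ)
    (p : V →L[ℝ] ℝ) : ‖c • p‖ = |c| * ‖p‖ := by rw [norm_smul, Real.norm_eq_abs]

theorem norm_add_dual_le {V : Type*} [NormedAddCommGroup V] [InnerProductSpace ℝ V]
    (p q : V →L[ℝ] ℝ) : ‖p + q‖ ≤ ‖p‖ + ‖q‖ := norm_add_le p q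

theorem norm_zero_dual {V : Type*} [NormedAddCommGroup V] [InnerProductSpace ℝ V] :
    ‖(0 : V →L[ℝ] ℝ)‖ = 0 := norm_zero

section JetNorm

variable {m : ℕ} {X : Type*} [TopologicalSpace X] [ChartedSpace (EuclideanSpace ℝ (Fin m)) X]
  [IsManifold (𝓡 m) ∞ X] [RiemannianBundle (fun x : X => TangentSpace (𝓡 m) x)]

theorem jetNorm_nonneg {x : X} (j : JetFiber (m := m) x) : 0 ≤ jetNorm j := Real.sqrt_nonneg _

theorem jetNorm_sq {x : X} (j : JetFiber (m := m) x) :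
    jetNorm j ^ 2 = j.1 ^ 2 + ‖j.2.1‖ ^ 2 + ∑ i, ∑ k,
      (j.2.2.1 (stdOrthonormalBasis ℝ (TangentSpace (𝓡 m) x) i)
        (stdOrthonormalBasis ℝ (TangentSpace (𝓡 m) x) k)) ^ 2 := by
  rw [jetNorm, Real.sq_sqrt]
  positivity

theorem abs_fst_le_jetNorm {x : X} (j : JetFiber (m := m) x) : |j.1| ≤ jetNorm j := by
  refine abs_le_of_sq_le_sq ?_ (jetNorm_nonneg j)
  rw [jetNorm_sq, add_assoc]
  exact le_add_of_nonneg_right (by positivity)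

theorem jetNorm_smul {x : X} (c : ℝ) (j : JetFiber (m := m) x) :
    jetNorm (c • j) = |c| * jetNorm j := by
  refine (sq_eq_sq₀ (jetNorm_nonneg _) (by positivity [jetNorm_nonneg j])).1 ?_
  rw [mul_pow, jetNorm_sq, jetNorm_sq, mul_add, mul_add, Finset.mul_sum]
  simp_rw [Finset.mul_sum]
  congr 1
  · congr 1
    · change (c * j.1) ^ 2 = _
      rw [mul_pow, sq_abs]
    · have h : ‖(c • j).2.1‖ = |c| * ‖j.2.1‖ :=
        norm_smul_dual (V := TangentSpace (𝓡 m) x) c j.2.1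
      rw [h, mul_pow]
  · refine Finset.sum_congr rfl fun i _ => Finset.sum_congr rfl fun k _ => ?_
    change (c * (j.2.2.1 _ _)) ^ 2 = _
    rw [mul_pow, sq_abs]

theorem jetNorm_neg {x : X} (j : JetFiber (m := m) x) : jetNorm (-j) = jetNorm j := by
  have h := jetNorm_smul (-1) j
  have e : (-1 : ℝ) • j = -j := Prod.ext (neg_one_smul ℝ j.1)
    (Prod.ext (neg_one_smul ℝ j.2.1) (neg_one_smul ℝ j.2.2))
  rwa [e, abs_neg, abs_one, one_mul] at h

theorem jetNorm_value {x : X} (r : ℝ) : jetNorm ((r, 0, 0) : JetFiber (m := m) x) = |r| := by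
  refine (sq_eq_sq₀ (jetNorm_nonneg _) (abs_nonneg r)).1 ?_
  have h : ‖((r, 0, 0) : JetFiber (m := m) x).2.1‖ = 0 :=
    norm_zero_dual (V := TangentSpace (𝓡 m) x)
  rw [jetNorm_sq, sq_abs, h]
  simp

theorem jetNorm_add_sq_le {x : X} (j k : JetFiber (m := m) x) :
    jetNorm (j + k) ^ 2 ≤ 2 * (jetNorm j ^ 2 + jetNorm k ^ 2) := by
  have hs : ∀ a b : ℝ, (a + b) ^ 2 ≤ 2 * (a ^ 2 + b ^ 2) := fun a b => by
    nlinarith [sq_nonneg (a - b)]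
  have h1 : (j + k).1 ^ 2 ≤ 2 * (j.1 ^ 2 + k.1 ^ 2) := hs _ _
  have h2 : ‖(j + k).2.1‖ ^ 2 ≤ 2 * (‖j.2.1‖ ^ 2 + ‖k.2.1‖ ^ 2) :=
    (pow_le_pow_left₀ (norm_nonneg _)
      (norm_add_dual_le (V := TangentSpace (𝓡 m) x) j.2.1 k.2.1) 2).trans
      (hs _ _)
  rw [jetNorm_sq, jetNorm_sq j, jetNorm_sq k]
  have h3 : ∀ i l : Fin (Module.finrank ℝ (TangentSpace (𝓡 m) x)),
      ((j + k).2.2.1 (stdOrthonormalBasis ℝ (TangentSpace (𝓡 m) x) i)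
        (stdOrthonormalBasis ℝ (TangentSpace (𝓡 m) x) l)) ^ 2 ≤
      2 * (j.2.2.1 (stdOrthonormalBasis ℝ (TangentSpace (𝓡 m) x) i)
        (stdOrthonormalBasis ℝ (TangentSpace (𝓡 m) x) l)) ^ 2 +
      2 * (k.2.2.1 (stdOrthonormalBasis ℝ (TangentSpace (𝓡 m) x) i)
        (stdOrthonormalBasis ℝ (TangentSpace (𝓡 m) x) l)) ^ 2 := fun i l => by
    rw [← mul_add]
    exact hs _ _
  have h4 := Finset.sum_le_sum fun i (_ : i ∈ Finset.univ) =>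
    Finset.sum_le_sum fun l (_ : l ∈ Finset.univ) => h3 i l
  simp only [Finset.sum_add_distrib, ← Finset.mul_sum] at h4
  linarith

/-- A jet in `G` at distance at least `c` from `∂G` is the centre of a ball of radius `c`
contained in `G`. -/
theorem add_mem_interior_of_jetNorm_lt {x : X} {G : Set (JetFiber (m := m) x)}
    {j k : JetFiber (m := m) x} {c : ℝ} (hj : j ∈ G)
    (hc : ∀ j' ∈ frontier G, c ≤ jetNorm (j - j')) (hk : jetNorm k < c) : j + k ∈ interior G := by
  -- The segment from `j` to `j + k` is connected and misses the frontier of `G`, so it stays in the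
  -- interior.
  set f : ℝ → JetFiber (m := m) x := fun t => j + t • k with hf
  have hcont : Continuous f := by fun_prop
  have hdist : ∀ t ∈ Set.Icc (0 : ℝ) 1, f t ∉ frontier G := by
    intro t ht hfr
    have h := hc _ hfr
    have e : j - f t = -(t • k) := by simp [hf]
    rw [e, jetNorm_neg, jetNorm_smul, abs_of_nonneg ht.1] at h
    have := mul_le_of_le_one_left (jetNorm_nonneg k) ht.2
    linarith
  have hpre : IsPreconnected (f '' Set.Icc (0 : ℝ) 1) :=
    isPreconnected_Icc.image f hcont.continuousOn
  have hsub : f '' Set.Icc (0 : ℝ) 1 ⊆ interior G := by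
    have h0 : f 0 ∈ G := by simpa [hf] using hj
    have h1 : (f '' Set.Icc (0 : ℝ) 1) ⊆ interior G ∪ (closure G)ᶜ := by
      rintro _ ⟨t, ht, rfl⟩
      by_cases h : f t ∈ interior G
      · exact Or.inl h
      · exact Or.inr fun h' => hdist t ht ⟨h', h⟩
    refine hpre.subset_left_of_subset_union isOpen_interior isClosed_closure.isOpen_compl ?_ h1 ?_
    · exact Set.disjoint_left.2 fun z hz hz' => hz' (subset_closure (interior_subset hz))
    · refine ⟨f 0, ⟨0, by simp, rfl⟩, ?_⟩
      rcases h1 ⟨0, by simp, rfl⟩ with h | h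
      · exact h
      · exact absurd (subset_closure h0) h
  have := hsub ⟨1, by simp, rfl⟩
  simpa [hf] using this

variable [IsContMDiffRiemannianBundle (𝓡 m) ∞ (EuclideanSpace ℝ (Fin m))
      (fun x : X => TangentSpace (𝓡 m) x)]

/-- The orthonormal bases in `jetNorm` are not chosen continuously. The Hessian is therefore bounded
through its coordinate form, which is continuous, and the norm of the trivialization, which is
locally bounded. -/
theorem exists_jetNorm_jetOf_le {u : X → ℝ} {x : X} (hu : ContMDiffAt (𝓡 m) 𝓘(ℝ) 2 u x) :
    ∃ C > 0, ∀ᶠ y in 𝓝 x, jetNorm (jetOf (m := m) u y).jet ≤ C := by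
  have hR : IsContMDiffRiemannianBundle (𝓡 m) 1 (EuclideanSpace ℝ (Fin m))
      (fun x : X => TangentSpace (𝓡 m) x) :=
    IsContMDiffRiemannianBundle.of_le (n := ∞) (by norm_cast)
  have hRc : IsContinuousRiemannianBundle (EuclideanSpace ℝ (Fin m))
      (fun x : X => TangentSpace (𝓡 m) x) := by
    obtain ⟨g, hg, hgi⟩ := hR.exists_contMDiff
    exact ⟨g, hg.continuous, hgi⟩
  obtain ⟨C1, hC1, h1⟩ := eventually_norm_trivializationAt_lt (EuclideanSpace ℝ (Fin m))
    (fun x : X => TangentSpace (𝓡 m) x) x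
  have hx := FiberBundle.mem_baseSet_trivializationAt' (F := EuclideanSpace ℝ (Fin m))
    (E := fun y : X => TangentSpace (𝓡 m) y) x
  have h2 := (continuousAt_hess_inCoordinates hu).norm.eventually_lt_const (lt_add_one _)
  set C2 := _ + (1 : ℝ) with hC2
  have h3 := (hu.continuousAt.pow 2).eventually_lt_const (lt_add_one _)
  have h4 := (((contMDiffAt_grad hu).inner_bundle
    (contMDiffAt_grad hu)).continuousAt).eventually_lt_const (lt_add_one _)
  set S := (u x ^ 2 + 1) + (inner ℝ (grad (m := m) u x) (grad u x) + 1) +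
    (m : ℝ) * (m * (C2 * C1 * C1) ^ 2) with hS
  have hSpos : 0 < S := by
    have : (0 : ℝ) ≤ inner ℝ (grad (m := m) u x) (grad u x) := real_inner_self_nonneg
    positivity
  refine ⟨√S, Real.sqrt_pos.2 hSpos, ?_⟩
  filter_upwards [h1, h2, h3, h4, (Bundle.Trivialization.open_baseSet _).mem_nhds hx]
    with y h1 h2 h3 h4 hy
  refine Real.le_sqrt_of_sq_le ?_
  rw [jetNorm_sq]
  have e4 : ‖(jetOf (m := m) u y).jet.2.1‖ ^ 2 = inner ℝ (grad (m := m) u y) (grad u y) := by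
    rw [real_inner_self_eq_norm_sq, norm_grad]
    rfl
  have hfr : Module.finrank ℝ (TangentSpace (𝓡 m) y) = m := by
    change Module.finrank ℝ (EuclideanSpace ℝ (Fin m)) = m
    simp
  have h5 : ∀ i k : Fin (Module.finrank ℝ (TangentSpace (𝓡 m) y)),
      ((jetOf (m := m) u y).jet.2.2.1 (stdOrthonormalBasis ℝ (TangentSpace (𝓡 m) y) i)
        (stdOrthonormalBasis ℝ (TangentSpace (𝓡 m) y) k)) ^ 2 ≤ (C2 * C1 * C1) ^ 2 := by
    intro i k
    set t := trivializationAt (EuclideanSpace ℝ (Fin m)) (fun y : X => TangentSpace (𝓡 m) y) x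
    set e := stdOrthonormalBasis ℝ (TangentSpace (𝓡 m) y)
    have hn : ∀ i, ‖t.continuousLinearMapAt ℝ y (e i)‖ ≤ C1 := by
      intro i
      refine (ContinuousLinearMap.le_opNorm _ _).trans ?_
      rw [e.orthonormal.1 i, mul_one]
      exact h1.le
    have hs : ∀ i, coordField m x (t.continuousLinearMapAt ℝ y (e i)) y = e i := by
      intro i
      rw [coordField, ← Trivialization.symmL_apply (R := ℝ) _ hy]
      exact t.symmL_continuousLinearMapAt hy _
    have hh := hess_inCoordinates u hy (t.continuousLinearMapAt ℝ y (e i))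
        (t.continuousLinearMapAt ℝ y (e k))
    rw [hs, hs] at hh
    change (hessAux u y (e i) (e k)) ^ 2 ≤ _
    rw [← hh, ← sq_abs]
    refine pow_le_pow_left₀ (abs_nonneg _) ?_ 2
    rw [← Real.norm_eq_abs]
    refine (ContinuousLinearMap.le_opNorm₂ _ _ _).trans ?_
    gcongr
    · exact hn i
    · exact hn k
  have h6 := Finset.sum_le_sum fun i (_ : i ∈ Finset.univ) =>
    Finset.sum_le_sum fun l (_ : l ∈ Finset.univ) => h5 i l
  simp only [Finset.sum_const, Finset.card_univ, Fintype.card_fin, nsmul_eq_mul, hfr] at h6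
  have h7 : (jetOf (m := m) u y).jet.1 ^ 2 = u y ^ 2 := rfl
  rw [e4, h7, hS]
  exact add_le_add (add_le_add h3.le h4.le) h6

end JetNorm

/-! ### Fibres of `F`, of the obstacle subequation and of their strict parts -/

section Fibres

variable {m : ℕ} {X : Type*} [TopologicalSpace X] [ChartedSpace (EuclideanSpace ℝ (Fin m)) X]
  [IsManifold (𝓡 m) ∞ X]

theorem Jet2.continuous_components : Continuous (Jet2.components (m := m) (X := X)) :=
  continuous_induced_dom

theorem Jet2.continuous_value : Continuous fun J : Jet2 m X => J.jet.1 :=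
  continuous_fst.comp Jet2.continuous_components

theorem Jet2.continuous_pt : Continuous fun J : Jet2 m X => J.pt :=
  (FiberBundle.continuous_proj (EuclideanSpace ℝ (Fin m) →L[ℝ] ℝ)
    (fun x : X => TangentSpace (𝓡 m) x →L[ℝ] ℝ)).comp
    (continuous_fst.comp (continuous_snd.comp Jet2.continuous_components))

theorem interior_inter_subset_interior_obstacle (F : Set (Jet2 m X)) {g : X → ℝ}
    (hg : Continuous g) :
    interior F ∩ {J | J.jet.1 < g J.pt} ⊆ interior (obstacle F g) := by
  refine interior_maximal ?_ (isOpen_interior.inter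
    (isOpen_lt Jet2.continuous_value (hg.comp Jet2.continuous_pt)))
  exact fun J hJ => ⟨interior_subset hJ.1, le_of_lt (show J.jet.1 < g J.pt from hJ.2)⟩

/-- Where the opposite jet has value below `g`, the obstacle is inactive. -/
theorem mem_dual_of_mem_dual_obstacle {F : Set (Jet2 m X)} {g : X → ℝ} (hg : Continuous g)
    {J : Jet2 m X} (hJ : J ∈ dual (obstacle F g)) (hr : -g J.pt < J.jet.1) : J ∈ dual F :=
  fun h => hJ (interior_inter_subset_interior_obstacle F hg ⟨h, neg_lt.1 hr⟩)

theorem IsSubequation.isClosed {F : Set (Jet2 m X)} (hF : IsSubequation F) : IsClosed F := by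
  rw [hF.eq_closure_interior]
  exact isClosed_closure

theorem IsSubequation.add_value_mem_interior {F : Set (Jet2 m X)} (hF : IsSubequation F) {x : X}
    {j : JetFiber (m := m) x} (hj : j ∈ interior (fiber F x)) {r : ℝ} (hr : r ≤ 0) :
    j + (r, 0, 0) ∈ interior (fiber F x) := by
  have h : (Homeomorph.addRight ((r, 0, 0) : JetFiber (m := m) x)) '' interior (fiber F x) ⊆
      interior (fiber F x) := by
    refine interior_maximal ?_ ((Homeomorph.isOpenMap _) _ isOpen_interior)
    rintro _ ⟨k, hk, rfl⟩
    exact hF.neg x k r hr (interior_subset hk)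
  exact h ⟨j, hj, rfl⟩

theorem fiber_obstacle (F : Set (Jet2 m X)) (g : X → ℝ) (x : X) :
    fiber (obstacle F g) x = fiber F x ∩ {j | j.1 ≤ g x} := rfl

variable [RiemannianBundle (fun x : X => TangentSpace (𝓡 m) x)]

/-- The open ball of radius `c` about the jet lies in the obstacle fibre. Hence it misses the
boundary of the fibre of `F`, and its vertical radius gives the gap to `g`. -/
theorem strictPart_obstacle_subset {F : Set (Jet2 m X)} {g : X → ℝ} {c : ℝ} (hc : 0 < c)
    {J : Jet2 m X} (hJ : J ∈ strictPart (obstacle F g) c) :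
    J ∈ strictPart F c ∧ J.jet.1 + c ≤ g J.pt := by
  obtain ⟨x, j⟩ := J
  obtain ⟨hJF, hJd⟩ := hJ
  refine ⟨⟨hJF.1, fun j' hj' => ?_⟩, ?_⟩
  · by_contra! h
    have h1 : jetNorm (j' - j) < c := by rwa [← neg_sub, jetNorm_neg]
    have h2 := add_mem_interior_of_jetNorm_lt (G := fiber (obstacle F g) x) hJF hJd h1
    rw [add_sub_cancel] at h2
    exact hj'.2 (interior_mono Set.inter_subset_left h2)
  · by_contra! h
    have hle : j.1 ≤ g x := hJF.2
    change g x < j.1 + c at h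
    -- A vertical shift halfway between the gap `g x - j.1` and `c` would cross the obstacle inside
    -- the ball.
    have h1 : jetNorm (((g x - j.1 + c) / 2, 0, 0) : JetFiber (m := m) x) < c := by
      rw [jetNorm_value, abs_of_nonneg (by linarith)]
      linarith
    have h2 := interior_subset
      (add_mem_interior_of_jetNorm_lt (G := fiber (obstacle F g) x) hJF hJd h1)
    have h3 : j.1 + (g x - j.1 + c) / 2 ≤ g x := h2.2
    linarith

/-- A boundary jet of the intersection is either a boundary jet of the fibre of `F` or has value
exactly `g x`. Both kinds are at distance at least `c`. -/
theorem mem_strictPart_obstacle {F : Set (Jet2 m X)} {g : X → ℝ} {c : ℝ} (hc : 0 < c)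
    {J : Jet2 m X} (hJ : J ∈ strictPart F c) (hr : J.jet.1 + c ≤ g J.pt) :
    J ∈ strictPart (obstacle F g) c := by
  obtain ⟨x, j⟩ := J
  refine ⟨⟨hJ.1, ?_⟩, fun j' hj' => ?_⟩
  · change j.1 ≤ g x
    change j.1 + c ≤ g x at hr
    linarith
  · rw [fiberBoundary, fiber_obstacle] at hj'
    rcases frontier_inter_subset _ _ hj' with h | h
    · exact hJ.2 j' h.1
    · have h1 : j'.1 = g x := frontier_le_subset_eq continuous_fst continuous_const h.2
      refine le_trans ?_ (abs_fst_le_jetNorm _)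
      change c ≤ |j.1 - j'.1|
      change j.1 + c ≤ g x at hr
      rw [abs_sub_comm, h1]
      exact le_abs.2 (Or.inl (by linarith))

/-- Negativity carries the ball of radius `c` in the fibre to its translate; a boundary jet too
close would thus be interior. -/
theorem IsSubequation.strictPart_add_value {F : Set (Jet2 m X)} (hF : IsSubequation F) {c : ℝ}
    {x : X} {j : JetFiber (m := m) x} (hJ : (⟨x, j⟩ : Jet2 m X) ∈ strictPart F c) {r : ℝ}
    (hr : r ≤ 0) : (⟨x, j + (r, 0, 0)⟩ : Jet2 m X) ∈ strictPart F c := by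
  refine ⟨hF.neg x j r hr hJ.1, fun j' hj' => ?_⟩
  by_contra! h
  have h1 : jetNorm (j' - (r, 0, 0) - j) < c := by
    have e : -(j' - (r, 0, 0) - j) = j + (r, 0, 0) - j' := by abel
    rw [← jetNorm_neg, e]
    exact h
  have h2 := add_mem_interior_of_jetNorm_lt (G := fiber F x) hJ.1 hJ.2 h1
  have h3 := hF.add_value_mem_interior h2 hr
  have e : j + (j' - (r, 0, 0) - j) + (r, 0, 0) = j' := by abel
  rw [e] at h3
  exact hj'.2 h3

theorem sub_jetNorm_sq_le {x : X} (j k j' : JetFiber (m := m) x) :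
    jetNorm (j - j') ^ 2 ≤ 2 * (jetNorm (j + k - j') ^ 2 + jetNorm k ^ 2) := by
  have h := jetNorm_add_sq_le (j + k - j') (-k)
  have e : j + k - j' + -k = j - j' := by abel
  rwa [e, jetNorm_neg] at h

theorem div_four_le_of_sq_le {a b c d : ℝ} (hc : 0 < c) (ha : 0 ≤ a) (hb : 0 ≤ b) (hac : a ≤ c / 4)
    (hd : c ≤ d) (h : d ^ 2 ≤ 2 * (b ^ 2 + a ^ 2)) : c / 4 ≤ b := by
  by_contra! hbc
  have h1 := pow_le_pow_left₀ hc.le hd 2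
  have h2 := pow_le_pow_left₀ ha hac 2
  have h3 := pow_le_pow_left₀ hb hbc.le 2
  linarith [pow_pos hc 2, div_pow c 4 2]

/-- The bound `|j + k|² ≤ 2 (|j|² + |k|²)` replaces the triangle inequality. Two terms of size `c /
4` give only `c² / 4 < c²`, so `c / 4` is ample. -/
theorem strictPart_add_of_jetNorm_le {F : Set (Jet2 m X)} {c : ℝ} (hc : 0 < c)
    {x : X} {j k : JetFiber (m := m) x} (hJ : (⟨x, j⟩ : Jet2 m X) ∈ strictPart F c)
    (hk : jetNorm k ≤ c / 4) : (⟨x, j + k⟩ : Jet2 m X) ∈ strictPart F (c / 4) := by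
  obtain ⟨h1, h2⟩ := hJ
  have h0 : j + k ∈ fiber F x := interior_subset
    (add_mem_interior_of_jetNorm_lt (G := fiber F x) h1 h2 (lt_of_le_of_lt hk (by linarith)))
  refine ⟨h0, fun j' hj' => ?_⟩
  exact div_four_le_of_sq_le hc (jetNorm_nonneg k) (jetNorm_nonneg _) hk (h2 j' hj')
    (sub_jetNorm_sq_le j k j')

end Fibres

/-! ### Semicontinuous functions plus continuous ones -/

section Semicontinuity

theorem ereal_add_coe_le_coe_iff {a : EReal} {r s : ℝ} :
    a + (r : EReal) ≤ (s : EReal) ↔ a ≤ ((s - r : ℝ) : EReal) := by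
  rw [EReal.coe_sub]
  exact (EReal.le_sub_iff_add_le (Or.inl (EReal.coe_ne_bot r)) (Or.inl (EReal.coe_ne_top r))).symm

theorem upperSemicontinuousOn_add_coe {Y : Type*} [TopologicalSpace Y] {K : Set Y} {u : Y → EReal}
    {r : Y → ℝ} (hu : UpperSemicontinuousOn u K) (hr : ContinuousOn r K) :
    UpperSemicontinuousOn (fun y => u y + (r y : EReal)) K := by
  refine UpperSemicontinuousOn.add' hu
    (fun y hy => ((continuous_coe_real_ereal.continuousAt.comp_continuousWithinAt
      (hr y hy)).upperSemicontinuousWithinAt)) ?_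
  intro y hy
  exact EReal.continuousAt_add (Or.inr (EReal.coe_ne_bot _)) (Or.inr (EReal.coe_ne_top _))

end Semicontinuity

/-! ### From test points to all points -/

section Tests

variable {m : ℕ} {X : Type*} [TopologicalSpace X] [T2Space X]
  [ChartedSpace (EuclideanSpace ℝ (Fin m)) X] [IsManifold (𝓡 m) ∞ X]

/-- A continuous upper bound for an upper semicontinuous function `u` at the points that admit a
test for `u` holds at all points. -/
theorem le_of_forall_isTest {u : X → EReal} {f : X → ℝ} {U : Set X} {x : X} (hU : IsOpen U)
    (hx : x ∈ U) (husc : UpperSemicontinuousOn u U) (htop : ∀ y ∈ U, u y < ⊤)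
    (hf : ContinuousAt f x) (htest : ∀ y ∈ U, ∀ φ : X → ℝ, IsTest m u y φ → φ y ≤ f y) :
    u x ≤ f x := by
  by_contra! h
  have : LocallyCompactSpace X := ChartedSpace.locallyCompactSpace (EuclideanSpace ℝ (Fin m)) X
  obtain ⟨b, hb1, hb2⟩ := EReal.lt_iff_exists_real_btwn.1 h
  rw [EReal.coe_lt_coe_iff] at hb1
  obtain ⟨ρ, hρ, hρ0, hρpos⟩ := exists_contMDiffAt_pos_of_ne (m := m) x
  have hUx : ∀ᶠ y in 𝓝 x, y ∈ U := hU.mem_nhds hx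
  have hev := hUx.and ((hf.eventually_lt_const hb1).and
    (hρpos.and (contMDiffAt_iff_contMDiffAt_nhds (by simp) |>.1 hρ)))
  obtain ⟨N, hN, hNsub, hNc⟩ := local_compact_nhds hev
  have huN : UpperSemicontinuousOn u N := husc.mono fun y hy => (hNsub hy).1
  have hρN : ContinuousOn ρ N := fun y hy => (hNsub hy).2.2.2.continuousAt.continuousWithinAt
  have hxN : x ∈ N := mem_of_mem_nhds hN
  obtain ⟨M, hM⟩ : ∃ M : ℝ, ∀ y ∈ N, u y ≤ M := by
    obtain ⟨z, hz, hzmax⟩ := huN.exists_isMaxOn ⟨x, hxN⟩ hNc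
    obtain ⟨M, hM, -⟩ := EReal.lt_iff_exists_real_btwn.1 (htop z (hNsub hz).1)
    exact ⟨M, fun y hy => (hzmax hy).trans hM.le⟩
  have hfr : frontier N ⊆ N := hNc.isClosed.frontier_subset
  obtain ⟨η, hη, hηρ⟩ := (hNc.of_isClosed_subset isClosed_frontier hfr).exists_forall_le'
    (hρN.mono hfr) (a := 0) fun y hy => (hNsub (hfr hy)).2.2.1 fun e =>
      hy.2 (e ▸ mem_interior_iff_mem_nhds.2 hN)
  -- The slope is so large that `u - l ρ ≤ M - l η < b` on the frontier of `N`. The maximum of `u -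
  -- l ρ` is thus interior, and there `u` has a test with value above `b > f`.
  set l := (|M - b| + 1) / η with hl
  have hlpos : 0 < l := by positivity
  have hlη : l * η = |M - b| + 1 := div_mul_cancel₀ _ hη.ne'
  obtain ⟨z, hz, hzmax⟩ := (upperSemicontinuousOn_add_coe huN
    (r := fun y => -(l * ρ y)) (by fun_prop)).exists_isMaxOn ⟨x, hxN⟩ hNc
  have hzval : (b : EReal) < u z + ((-(l * ρ z) : ℝ) : EReal) := by
    refine lt_of_lt_of_le ?_ (hzmax hxN)
    simpa [hρ0] using hb2
  have hzint : z ∈ interior N := by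
    by_contra hni
    have hzf : z ∈ frontier N := ⟨subset_closure hz, hni⟩
    have h1 : u z + ((-(l * ρ z) : ℝ) : EReal) ≤ (b : EReal) := by
      rw [ereal_add_coe_le_coe_iff]
      refine (hM z hz).trans (EReal.coe_le_coe_iff.2 ?_)
      have := mul_le_mul_of_nonneg_left (hηρ z hzf) hlpos.le
      have := le_abs_self (M - b)
      linarith
    exact absurd hzval (not_lt.2 h1)
  have hzbot : u z ≠ ⊥ := by
    intro e
    rw [e, EReal.bot_add] at hzval
    exact not_lt_bot hzval
  obtain ⟨c, hc⟩ : ∃ c : ℝ, (c : EReal) = u z :=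
    ⟨(u z).toReal, EReal.coe_toReal (htop z (hNsub hz).1).ne hzbot⟩
  have hzρ : 0 ≤ ρ z := by
    rcases eq_or_ne z x with e | e
    · rw [e, hρ0]
    · exact ((hNsub hz).2.2.1 e).le
  have htz := htest z (hNsub hz).1 (fun y => (c - l * ρ z) + l * ρ y) ⟨?_, ?_, ?_⟩
  · rw [← hc, ← EReal.coe_add, EReal.coe_lt_coe_iff] at hzval
    have := (hNsub hz).2.1
    have := mul_nonneg hlpos.le hzρ
    simp only [sub_add_cancel] at htz
    linarith
  · exact contMDiffAt_const.add (contMDiffAt_const.mul (hNsub hz).2.2.2)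
  · filter_upwards [isOpen_interior.mem_nhds hzint] with y hy
    have h1 := hzmax (interior_subset hy)
    change u y + ((-(l * ρ y) : ℝ) : EReal) ≤ u z + ((-(l * ρ z) : ℝ) : EReal) at h1
    rw [← hc, ← EReal.coe_add, ereal_add_coe_le_coe_iff] at h1
    refine h1.trans_eq ?_
    congr 1
    ring
  · rw [← hc]
    congr 1
    ring

end Tests

/-! ### Calculus of jets, and maxima of dual subharmonic functions -/

section Jets

variable {m : ℕ} {X : Type*} [TopologicalSpace X] [T2Space X]
  [ChartedSpace (EuclideanSpace ℝ (Fin m)) X] [IsManifold (𝓡 m) ∞ X]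
  [RiemannianBundle (fun x : X => TangentSpace (𝓡 m) x)]

theorem mvfderiv_const_mul {u : X → ℝ} {x : X} (c : ℝ) (hu : MDifferentiableAt (𝓡 m) 𝓘(ℝ) u x) :
    mvfderiv (𝓡 m) (fun y => c * u y) x = c • mvfderiv (𝓡 m) u x := by
  rw [mvfderiv_fun_mul mdifferentiableAt_const hu, mvfderiv_const]
  ext v
  simp

theorem grad_const_mul {u : X → ℝ} {x : X} (c : ℝ) (hu : MDifferentiableAt (𝓡 m) 𝓘(ℝ) u x) :
    grad (m := m) (fun y => c * u y) x = c • grad u x := by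
  rw [grad, mvfderiv_const_mul c hu, map_smulₛₗ]
  rfl

variable [IsContMDiffRiemannianBundle (𝓡 m) ∞ (EuclideanSpace ℝ (Fin m))
      (fun x : X => TangentSpace (𝓡 m) x)]

theorem hess_const_mul {u : X → ℝ} {x : X} (c : ℝ) (hu : ContMDiffAt (𝓡 m) 𝓘(ℝ) 2 u x) :
    hess (m := m) (fun y => c * u y) x = c • hess u x := by
  have he : (grad (m := m) (fun y => c * u y)) =ᶠ[𝓝 x] c • grad u := by
    filter_upwards [contMDiffAt_iff_contMDiffAt_nhds (by simp) |>.1 hu] with y h1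
    exact grad_const_mul c (h1.mdifferentiableAt (by simp))
  have hb : ∀ V : ∀ y : X, TangentSpace (𝓡 m) y,
      VectorField.mlieBracket (𝓡 m) (grad (fun y => c * u y)) V x =
      c • VectorField.mlieBracket (𝓡 m) (grad u) V x := by
    intro V
    rw [← VectorField.mlieBracket_const_smul_left
      ((contMDiffAt_grad hu).mdifferentiableAt (by simp))]
    exact Filter.EventuallyEq.mlieBracket_vectorField_eq he (Filter.EventuallyEq.refl _ _)
  apply Subtype.ext
  ext v v'
  change hessAux (fun y => c * u y) x v v' = c * hessAux u x v v'
  simp only [hessAux]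
  rw [hb, hb, grad_const_mul c (hu.mdifferentiableAt (by simp)), map_smul]
  simp only [real_inner_smul_left, real_inner_smul_right, smul_eq_mul]
  ring

theorem jetOf_const_mul {u : X → ℝ} {x : X} (c : ℝ) (hu : ContMDiffAt (𝓡 m) 𝓘(ℝ) 2 u x) :
    jetOf (m := m) (fun y => c * u y) x = ⟨x, c • (jetOf u x).jet⟩ := by
  simp only [jetOf, hess_const_mul c hu, mvfderiv_const_mul c (hu.mdifferentiableAt (by simp))]
  rfl

theorem jetOf_add_of_eq {u w : X → ℝ} {x : X} (hu : ContMDiffAt (𝓡 m) 𝓘(ℝ) 2 u x)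
    (hw : ContMDiffAt (𝓡 m) 𝓘(ℝ) 2 w x) {j l : JetFiber (m := m) x} (hj : jetOf u x = ⟨x, j⟩)
    (hl : jetOf w x = ⟨x, l⟩) : jetOf (u + w) x = ⟨x, j + l⟩ := by
  obtain rfl : (jetOf u x).jet = j := (Jet2.mk.inj hj).2
  obtain rfl : (jetOf w x).jet = l := (Jet2.mk.inj hl).2
  exact jetOf_add hu hw

theorem jetOf_add_const {u : X → ℝ} {x : X} (hu : ContMDiffAt (𝓡 m) 𝓘(ℝ) 2 u x)
    {j : JetFiber (m := m) x} (hj : jetOf u x = ⟨x, j⟩) (c : ℝ) :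
    jetOf (m := m) (fun y => u y + c) x = ⟨x, j + (c, 0, 0)⟩ := by
  exact jetOf_add_of_eq hu contMDiffAt_const hj (jetOf_const c x)

/-- If `χ + θ` has a local minimum with value `0`, the jet of `θ` is obtained from the opposite of
the jet of `χ` by adding a nonnegative quadratic form. -/
theorem exists_jetOf_eq_neg_add {χ θ : X → ℝ} {x : X} (hχ : ContMDiffAt (𝓡 m) 𝓘(ℝ) 2 χ x)
    (hθ : ContMDiffAt (𝓡 m) 𝓘(ℝ) 2 θ x) (hle : ∀ᶠ y in 𝓝 x, 0 ≤ χ y + θ y)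
    (h0 : χ x + θ x = 0) {j : JetFiber (m := m) x} (hj : jetOf χ x = ⟨x, j⟩) :
    ∃ P : SymForm (m := m) x, (∀ v, 0 ≤ P.1 v v) ∧
      jetOf θ x = ⟨x, -j + (0, 0, P)⟩ := by
  have hmin : IsLocalMin (χ + θ) x := by
    filter_upwards [hle] with y hy
    change χ x + θ x ≤ χ y + θ y
    rwa [h0]
  have hC : ContMDiffAt (𝓡 m) 𝓘(ℝ) 2 (χ + θ) x := hχ.add hθ
  have h1 := mvfderiv_eq_zero_of_isLocalMin (m := m) hmin (hC.mdifferentiableAt (by simp))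
  refine ⟨hess (χ + θ) x, fun v => hess_nonneg_of_isLocalMin hmin hC v, ?_⟩
  obtain ⟨l, hl⟩ : ∃ l : JetFiber (m := m) x, jetOf θ x = ⟨x, l⟩ := ⟨(jetOf θ x).jet, rfl⟩
  have h2 := jetOf_add_of_eq hχ hθ hj hl
  have h3 : jetOf (m := m) (χ + θ) x = ⟨x, (0, 0, hess (χ + θ) x)⟩ := by
    rw [jetOf, h1]
    congr 2
  have h4 : ((0, 0, hess (χ + θ) x) : JetFiber (m := m) x) = j + l :=
    (Jet2.mk.inj (h3.symm.trans h2)).2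
  rw [h4, hl, neg_add_cancel_left]

theorem IsTest.sub {u : X → EReal} {r φ : X → ℝ} {x : X}
    (h : IsTest m (fun y => u y + (r y : EReal)) x φ) (hr : ContMDiffAt (𝓡 m) 𝓘(ℝ) 2 r x) :
    IsTest m u x (fun y => φ y - r y) := by
  obtain ⟨h1, h2, h3⟩ := h
  refine ⟨h1.sub hr, ?_, ?_⟩
  · filter_upwards [h2] with y hy
    exact ereal_add_coe_le_coe_iff.1 hy
  · refine le_antisymm ?_ (ereal_add_coe_le_coe_iff.1 h3.ge)
    rw [EReal.coe_sub, h3]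
    exact EReal.sub_le_of_le_add le_rfl

theorem IsSubequation.mem_dual_iff {F : Set (Jet2 m X)} (hF : IsSubequation F) {x : X}
    {j : JetFiber (m := m) x} : (⟨x, j⟩ : Jet2 m X) ∈ dual F ↔ -j ∉ interior (fiber F x) := by
  rw [← hF.fiber_interior]
  rfl

/-- The maximum of a lowered obstacle dual subharmonic function with a smooth function `-θ`
whose dual jets avoid `F` is dual subharmonic, provided that `-θ` dominates wherever the obstacle
could be active. -/
theorem testsIn_dual_sup {F : Set (Jet2 m X)} (hF : IsSubequation F) {g : X → ℝ}
    (hg : Continuous g) {v : X → EReal} {θ : X → ℝ} {s : ℝ} (hs : 0 ≤ s) {U : Set X}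
    (hv : TestsIn (dual (obstacle F g)) U v) (hθ : ∀ y ∈ U, ContMDiffAt (𝓡 m) 𝓘(ℝ) 2 θ y)
    (hθF : ∀ y ∈ U, jetOf θ y ∉ F) (hθg : ∀ y ∈ U, θ y - s < g y) :
    TestsIn (dual F) U (fun y => (v y + ((-s : ℝ) : EReal)) ⊔ ((-θ y : ℝ) : EReal)) := by
  rintro x hx χ ⟨hC, hle, heq⟩
  change (χ x : EReal) = (v x + ((-s : ℝ) : EReal)) ⊔ ((-θ x : ℝ) : EReal) at heq
  have hθx : -θ x ≤ χ x := EReal.coe_le_coe_iff.1 (le_sup_right.trans_eq heq.symm)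
  obtain ⟨j, hj⟩ : ∃ j : JetFiber (m := m) x, jetOf χ x = ⟨x, j⟩ := ⟨(jetOf χ x).jet, rfl⟩
  rw [hj, hF.mem_dual_iff]
  intro hmem
  rcases le_total (v x + ((-s : ℝ) : EReal)) ((-θ x : ℝ) : EReal) with h | h
  · rw [sup_eq_right.2 h, EReal.coe_eq_coe_iff] at heq
    obtain ⟨P, hP, hP'⟩ := exists_jetOf_eq_neg_add hC (hθ x hx)
      (by filter_upwards [hle] with y hy
          have := EReal.coe_le_coe_iff.1 (le_sup_right.trans hy)
          linarith) (by linarith) hj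
    apply hθF x hx
    rw [hP']
    exact hF.pos x _ P hP (interior_subset hmem)
  · rw [sup_eq_left.2 h] at heq
    have ht : IsTest m v x (fun y => χ y - -s) :=
      IsTest.sub (r := fun _ => -s) ⟨hC, hle.mono fun y hy => le_sup_left.trans hy, heq⟩
        contMDiffAt_const
    have h1 := hv x hx _ ht
    simp only [sub_neg_eq_add] at h1
    rw [jetOf_add_const hC hj] at h1
    have h2 := mem_dual_of_mem_dual_obstacle hg h1 (by
      have := hθg x hx
      have hjx : χ x = j.1 := congrArg (fun J : Jet2 m X => J.jet.1) hj
      change -g x < j.1 + s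
      linarith)
    rw [hF.mem_dual_iff] at h2
    apply h2
    -- Negativity transfers the conclusion from `χ + s` back to `χ`.
    have h3 := hF.add_value_mem_interior hmem (r := -s) (by linarith)
    convert h3 using 1
    rw [neg_add]
    congr 1
    exact Prod.ext rfl (Prod.ext neg_zero neg_zero)

theorem TestsIn.mono {F G : Set (Jet2 m X)} {U V : Set X} {u : X → EReal} (h : TestsIn F U u)
    (hFG : F ⊆ G) (hVU : V ⊆ U) : TestsIn G V u :=
  fun x hx φ hφ => hFG (h x (hVU hx) φ hφ)

theorem strictPart_anti (F : Set (Jet2 m X)) {c c' : ℝ} (h : c' ≤ c) :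
    strictPart F c ⊆ strictPart F c' :=
  fun _ hJ => ⟨hJ.1, fun j' hj' => h.trans (hJ.2 j' hj')⟩

theorem IsUSC.mono {K L : Set X} {u : X → EReal} (h : IsUSC K u) (hLK : L ⊆ K) : IsUSC L u :=
  ⟨h.1.mono hLK, fun x hx => h.2 x (hLK hx)⟩

theorem IsUSC.add_coe {K : Set X} {u : X → EReal} {r : X → ℝ} (h : IsUSC K u)
    (hr : ContinuousOn r K) : IsUSC K (fun y => u y + (r y : EReal)) :=
  ⟨upperSemicontinuousOn_add_coe h.1 hr, fun x hx => EReal.add_lt_top (h.2 x hx).ne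
    (EReal.coe_ne_top _)⟩

theorem IsUSC.sup_coe {K : Set X} {u : X → EReal} {r : X → ℝ} (h : IsUSC K u)
    (hr : ContinuousOn r K) : IsUSC K (fun y => u y ⊔ (r y : EReal)) :=
  ⟨h.1.sup fun y hy => (continuous_coe_real_ereal.continuousAt.comp_continuousWithinAt
    (hr y hy)).upperSemicontinuousWithinAt, fun x hx => sup_lt_iff.2 ⟨h.2 x hx, EReal.coe_lt_top _⟩⟩

theorem le_sub_of_testsIn {g : X → ℝ} (hg : Continuous g) {K : Set X}
    {u : X → EReal} (hu : IsUSC K u) {δ : ℝ} {G : Set (Jet2 m X)}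
    (hG : ∀ J ∈ G, J.jet.1 + δ ≤ g J.pt) (ht : TestsIn G (interior K) u) {x : X}
    (hx : x ∈ interior K) : u x ≤ ((g x - δ : ℝ) : EReal) := by
  have h := hu.mono interior_subset
  refine le_of_forall_isTest (m := m) (f := fun y => g y - δ) isOpen_interior hx h.1 h.2
    (by fun_prop) fun y hy φ hφ => ?_
  have : φ y + δ ≤ g y := hG _ (ht y hy φ hφ)
  linarith

end Jets

/-! ### Strict approximation, and tools for comparison -/

section Obstacle

variable {m : ℕ} {X : Type*} [TopologicalSpace X] [T2Space X]
  [ChartedSpace (EuclideanSpace ℝ (Fin m)) X] [IsManifold (𝓡 m) ∞ X]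
  [RiemannianBundle (fun x : X => TangentSpace (𝓡 m) x)]
  [IsContMDiffRiemannianBundle (𝓡 m) ∞ (EuclideanSpace ℝ (Fin m))
      (fun x : X => TangentSpace (𝓡 m) x)]

/-- Strict subharmonicity is preserved when a function is lowered by a constant. -/
theorem IsSubequation.testsIn_sub_const {F : Set (Jet2 m X)} (hF : IsSubequation F) {c r : ℝ}
    (hr : r ≤ 0) {w : X → EReal} {U : Set X} (hw : TestsIn (strictPart F c) U w) :
    TestsIn (strictPart F c) U (fun y => w y + (r : EReal)) := by
  intro x hx φ hφ
  obtain ⟨j, hj⟩ : ∃ j : JetFiber (m := m) x, jetOf φ x = ⟨x, j⟩ := ⟨(jetOf φ x).jet, rfl⟩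
  have h1 := hw x hx _ (IsTest.sub (r := fun _ => r) hφ contMDiffAt_const)
  simp only [sub_eq_add_neg] at h1
  rw [jetOf_add_const hφ.1 hj] at h1
  have h2 := hF.strictPart_add_value h1 hr
  have e : j + (-r, 0, 0) + (r, 0, 0) = j := by
    have e1 : ((-r, 0, 0) : JetFiber (m := m) x) = -(r, 0, 0) :=
      Prod.ext rfl (Prod.ext neg_zero.symm neg_zero.symm)
    rw [e1, neg_add_cancel_right]
  rw [hj]
  rwa [e] at h2

theorem IsSubequation.strictApproximation_obstacle {F : Set (Jet2 m X)} (hF : IsSubequation F)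
    {g : X → ℝ} (hg : Continuous g) {Ω : Set X} (h : StrictApproximation F Ω) :
    StrictApproximation (obstacle F g) Ω := by
  intro K hKΩ hK u hu ε hε
  obtain ⟨w, ⟨hw, hwt⟩, hwu⟩ := h K hKΩ hK u ⟨hu.1, hu.2.mono (fun _ hJ => hJ.1) subset_rfl⟩
    (ε / 4) (by positivity)
  -- Lowering by `ε / 2` absorbs the approximation error `ε / 4` and leaves a gap of `ε / 4` below
  -- `g`; the total error is at most `3ε / 4`.
  refine ⟨fun y => w y + ((-(ε / 2) : ℝ) : EReal), ⟨hw.add_coe continuousOn_const, ?_⟩, ?_⟩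
  · intro x hx
    obtain ⟨B, hB, c, hc, hBt⟩ := hwt x hx
    refine ⟨B ∩ interior K, Filter.inter_mem hB (isOpen_interior.mem_nhds hx), min c (ε / 4),
      by positivity, fun y hy φ hφ => ?_⟩
    refine mem_strictPart_obstacle (by positivity) (strictPart_anti F (min_le_left _ _)
      (hF.testsIn_sub_const (by linarith) hBt y hy.1 φ hφ)) ?_
    have h1 : u y ≤ ((g y - 0 : ℝ) : EReal) := le_sub_of_testsIn hg hu.1
      (G := obstacle F g) (fun J hJ => by rw [add_zero]; exact hJ.2) hu.2 hy.2
    have h2 := (hwu y (interior_subset hy.2)).2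
    have h3 : ((φ y : ℝ) : EReal) ≤ ((g y - 0 + ε / 4 + -(ε / 2) : ℝ) : EReal) := by
      rw [hφ.2.2, EReal.coe_add, EReal.coe_add]
      exact add_le_add_left (h2.trans (add_le_add_left h1 _)) _
    have h4 := EReal.coe_le_coe_iff.1 h3
    have h5 := min_le_right c (ε / 4)
    change φ y + min c (ε / 4) ≤ g y
    linarith
  · intro x hx
    obtain ⟨h1, h2⟩ := hwu x hx
    constructor
    · rw [add_assoc, ← EReal.coe_add]
      exact h1.trans (add_le_add_right (EReal.coe_le_coe_iff.2 (by linarith)) _)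
    · refine (add_le_add_left h2 _).trans ?_
      rw [add_assoc, ← EReal.coe_add]
      exact add_le_add_right (EReal.coe_le_coe_iff.2 (by linarith)) _

theorem add_coe_add_add_coe_le {a b : EReal} {t s M : ℝ} (h : a + b ≤ M) (hM : M + t + s ≤ 0) :
    a + (t : EReal) + (b + (s : EReal)) ≤ 0 := by
  rw [add_add_add_comm, ← EReal.coe_add]
  refine (add_le_add_left h _).trans ?_
  rw [← EReal.coe_add]
  exact EReal.coe_le_coe_iff.2 (by linarith)

/-- If the jets of `θ` avoid `F`, weak comparison for `F` applies to `u` and the maximum of `v - s`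
and `-θ`, where `v` is subharmonic for the dual of the obstacle subequation. -/
theorem WeakComparison.add_sup_le {F : Set (Jet2 m X)} (hF : IsSubequation F) {g : X → ℝ}
    (hg : Continuous g) {Ω : Set X} (hcomp : WeakComparison F Ω) {N : Set X} (hNΩ : N ⊆ Ω)
    (hN : IsCompact N) {c : ℝ} (hc : 0 < c) {u v : X → EReal} (hu : u ∈ Sub (strictPart F c) N)
    (hv : v ∈ Sub (dual (obstacle F g)) N) {θ : X → ℝ} {s : ℝ} (hs : 0 ≤ s)
    (hθ : ∀ y ∈ N, ContMDiffAt (𝓡 m) 𝓘(ℝ) 2 θ y) (hθF : ∀ y ∈ N, jetOf θ y ∉ F)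
    (hθg : ∀ y ∈ N, θ y - s < g y)
    (hfr1 : ∀ y ∈ frontier N, u y + (v y + ((-s : ℝ) : EReal)) ≤ 0)
    (hfr2 : ∀ y ∈ frontier N, u y + ((-θ y : ℝ) : EReal) ≤ 0) {x : X} (hx : x ∈ N) :
    u x + (v x + ((-s : ℝ) : EReal)) ≤ 0 := by
  have hv' : (fun y => (v y + ((-s : ℝ) : EReal)) ⊔ ((-θ y : ℝ) : EReal)) ∈ Sub (dual F) N := by
    refine ⟨(hv.1.add_coe continuousOn_const).sup_coe fun y hy =>
      (hθ y hy).continuousAt.continuousWithinAt.neg, ?_⟩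
    exact testsIn_dual_sup hF hg hs hv.2 (fun y hy => hθ y (interior_subset hy))
      (fun y hy => hθF y (interior_subset hy)) (fun y hy => hθg y (interior_subset hy))
  refine le_trans (add_le_add_right le_sup_left _) (hcomp N hNΩ hN c hc u hu _ hv' ?_ x hx)
  intro y hy
  rcases le_total (v y + ((-s : ℝ) : EReal)) ((-θ y : ℝ) : EReal) with h | h
  · simp only [sup_eq_right.2 h]
    exact hfr2 y hy
  · simp only [sup_eq_left.2 h]
    exact hfr1 y hy

/-- A function whose jet at a point lies outside `F` has its jets outside `F` nearby. -/
theorem eventually_jetOf_notMem {F : Set (Jet2 m X)} (hF : IsSubequation F) {θ : X → ℝ} {x : X}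
    (hθ : ContMDiffAt (𝓡 m) 𝓘(ℝ) 2 θ x) (h : jetOf θ x ∉ F) :
    ∀ᶠ y in 𝓝 x, ContMDiffAt (𝓡 m) 𝓘(ℝ) 2 θ y ∧ jetOf θ y ∉ F :=
  ((contMDiffAt_iff_contMDiffAt_nhds (by simp)).1 hθ).and
    ((continuousAt_jetOf hθ).eventually (hF.isClosed.isOpen_compl.mem_nhds h))

/-- Subtracting `ε ρ` moves test jets by at most `c / 4`. Subtracting the constant `d` costs
nothing, by negativity, however large `d` is. -/
theorem strictPart_of_testsIn_perturb {F : Set (Jet2 m X)} (hF : IsSubequation F) {c C ε d : ℝ}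
    (hc : 0 < c) (hε : 0 ≤ ε) (hεC : ε * C ≤ c / 4) (hd : 0 ≤ d) {u : X → EReal} {ρ : X → ℝ}
    {U : Set X} (hu : TestsIn (strictPart F c) U u)
    (hρ : ∀ y ∈ U, ContMDiffAt (𝓡 m) 𝓘(ℝ) 2 ρ y)
    (hρC : ∀ y ∈ U, jetNorm (jetOf (m := m) ρ y).jet ≤ C) :
    TestsIn (strictPart F (c / 4)) U (fun y => u y + ((-(ε * ρ y + d) : ℝ) : EReal)) := by
  intro x hx φ hφ
  have hr : ContMDiffAt (𝓡 m) 𝓘(ℝ) 2 (fun y => -ε * ρ y) x := contMDiffAt_const.mul (hρ x hx)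
  have hr' : ContMDiffAt (𝓡 m) 𝓘(ℝ) 2 (fun y => -(ε * ρ y + d)) x :=
    ((contMDiffAt_const.mul (hρ x hx)).add contMDiffAt_const).neg
  have ht := hφ.sub hr'
  set χ : X → ℝ := fun y => φ y - -(ε * ρ y + d) with hχ
  have h1 := hu x hx _ ht
  obtain ⟨j, hj⟩ : ∃ j : JetFiber (m := m) x, jetOf χ x = ⟨x, j⟩ := ⟨(jetOf χ x).jet, rfl⟩
  rw [hj] at h1
  have h2 := strictPart_add_of_jetNorm_le (k := -ε • (jetOf (m := m) ρ x).jet) hc h1 (by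
    rw [jetNorm_smul, abs_neg, abs_of_nonneg hε]
    exact (mul_le_mul_of_nonneg_left (hρC x hx) hε).trans hεC)
  have h3 := hF.strictPart_add_value h2 (r := -d) (by linarith)
  have h4 := jetOf_add_const (ht.1.add hr)
    (jetOf_add_of_eq ht.1 hr hj (jetOf_const_mul (-ε) (hρ x hx))) (-d)
  have e : (fun y => (χ + fun y => -ε * ρ y) y + -d) = φ := by
    funext y
    simp only [hχ, Pi.add_apply]
    ring
  rw [← e]
  exact h4 ▸ h3

end Obstacle

/-! ### Weak comparison for the obstacle subequation -/

section Comparison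

variable {m : ℕ} {X : Type*} [TopologicalSpace X] [T2Space X]
  [ChartedSpace (EuclideanSpace ℝ (Fin m)) X] [IsManifold (𝓡 m) ∞ X]
  [RiemannianBundle (fun x : X => TangentSpace (𝓡 m) x)]
  [IsContMDiffRiemannianBundle (𝓡 m) ∞ (EuclideanSpace ℝ (Fin m))
      (fun x : X => TangentSpace (𝓡 m) x)]

theorem sub_mono {F G : Set (Jet2 m X)} {K N : Set X} {u : X → EReal} (hu : u ∈ Sub F K)
    (hFG : F ⊆ G) (hNK : N ⊆ K) : u ∈ Sub G N :=
  ⟨hu.1.mono hNK, hu.2.mono hFG (interior_mono hNK)⟩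

/-- By negativity, raising the value of a jet outside `F` keeps it outside. -/
theorem IsSubequation.exists_notMem_of_le {F : Set (Jet2 m X)} (hF : IsSubequation F) {x : X}
    {j : JetFiber (m := m) x} (hj : j ∉ fiber F x) {r : ℝ} (hr : j.1 ≤ r) :
    ∃ θ : X → ℝ, ContMDiffAt (𝓡 m) 𝓘(ℝ) 2 θ x ∧ θ x = r ∧ jetOf θ x ∉ F := by
  obtain ⟨θ, hθ, hθj⟩ := exists_jetOf_eq x ((r, j.2) : JetFiber (m := m) x)
  refine ⟨θ, hθ, congrArg (fun J : Jet2 m X => J.jet.1) hθj, fun h => hj ?_⟩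
  rw [hθj] at h
  have h1 := hF.neg x _ (j.1 - r) (by linarith) h
  have e : ((r, j.2) : JetFiber (m := m) x) + (j.1 - r, 0, 0) = j :=
    Prod.ext (add_sub_cancel r j.1) (Prod.ext (add_zero _) (add_zero _))
  rwa [e] at h1

/-- If some jet below the obstacle at `x` is not in `F`, then `u + v` has no positive interior
maximum at `x`. -/
theorem false_of_notMem_of_lt_obstacle {F : Set (Jet2 m X)} (hF : IsSubequation F) {g : X → ℝ}
    (hg : Continuous g) {Ω : Set X} (hcomp : WeakComparison F Ω) {K : Set X} (hKΩ : K ⊆ Ω)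
    {c : ℝ} (hc : 0 < c) {u v : X → EReal} (hu : u ∈ Sub (strictPart F c) K)
    (hug : ∀ y ∈ interior K, u y ≤ ((g y - c : ℝ) : EReal))
    (hv : v ∈ Sub (dual (obstacle F g)) K) {x : X} (hx : x ∈ interior K) {a b : ℝ}
    (ha : u x = a) (hb : v x = b) (hab : 0 < a + b)
    (hmax : ∀ y ∈ interior K, u y + v y ≤ ((a + b : ℝ) : EReal))
    {j : JetFiber (m := m) x} (hj : j ∉ fiber F x) (hjg : j.1 < g x) : False := by
  have : LocallyCompactSpace X := ChartedSpace.locallyCompactSpace (EuclideanSpace ℝ (Fin m)) X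
  -- The value is placed strictly between `g x - c` and `g x`: the upper bound makes the obstacle
  -- inactive where `v ≥ -θ`, the lower one gives `u - θ < 0` on the frontier of `N`.
  obtain ⟨θ, hθ, hθx, hθF⟩ := hF.exists_notMem_of_le hj (le_max_left j.1 (g x - c / 2))
  have hθg : θ x < g x := by
    rw [hθx]
    exact max_lt hjg (by linarith)
  have hgθ : g x - c < θ x := by
    rw [hθx]
    exact lt_of_lt_of_le (by linarith) (le_max_right _ _)
  obtain ⟨ρ, hρ, hρ0, hρpos⟩ := exists_contMDiffAt_pos_of_ne (m := m) x
  obtain ⟨C, hC, hρC⟩ := exists_jetNorm_jetOf_le hρ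
  have hxK : ∀ᶠ y in 𝓝 x, y ∈ interior K := isOpen_interior.mem_nhds hx
  have hev := hxK.and ((eventually_jetOf_notMem hF hθ hθF).and
    ((hθ.continuousAt.eventually_lt hg.continuousAt hθg).and
    (((hg.sub continuous_const).continuousAt.eventually_lt hθ.continuousAt hgθ).and
    (hρpos.and (hρC.and (contMDiffAt_iff_contMDiffAt_nhds (by simp) |>.1 hρ))))))
  obtain ⟨N, hN, hNsub, hNc⟩ := local_compact_nhds hev
  have hNK : N ⊆ interior K := fun y hy => (hNsub hy).1
  have hxN : x ∈ N := mem_of_mem_nhds hN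
  have hρN : ContinuousOn ρ N := fun y hy =>
    (hNsub hy).2.2.2.2.2.2.continuousAt.continuousWithinAt
  have hfr : frontier N ⊆ N := hNc.isClosed.frontier_subset
  obtain ⟨η, hη, hηρ⟩ := (hNc.of_isClosed_subset isClosed_frontier hfr).exists_forall_le'
    (hρN.mono hfr) (a := 0) fun y hy => (hNsub (hfr hy)).2.2.2.2.1 fun e =>
      hy.2 (e ▸ mem_interior_iff_mem_nhds.2 hN)
  -- The first bound preserves strictness, the second makes the constant `a + b - ε η` below
  -- nonnegative.
  set ε := min (c / 4 / C) ((a + b) / η) with hεdef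
  have hε : 0 < ε := by positivity
  have hεC : ε * C ≤ c / 4 := (le_div_iff₀ hC).1 (min_le_left _ _)
  have hεη : ε * η ≤ a + b := (le_div_iff₀ hη).1 (min_le_right _ _)
  -- With this constant, the sum with `v` is at most `0` on the frontier, where `ρ ≥ η`, but equals
  -- `ε η > 0` at `x`.
  have huN : (fun y => u y + ((-(ε * ρ y + (a + b - ε * η)) : ℝ) : EReal)) ∈
      Sub (strictPart F (c / 4)) N :=
    ⟨(hu.1.mono (hNK.trans interior_subset)).add_coe (by fun_prop),
      strictPart_of_testsIn_perturb hF hc hε.le hεC (by linarith)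
        (hu.2.mono subset_rfl (interior_subset.trans hNK))
        (fun y hy => (hNsub (interior_subset hy)).2.2.2.2.2.2)
        (fun y hy => (hNsub (interior_subset hy)).2.2.2.2.2.1)⟩
  have hfin := hcomp.add_sup_le hF hg ((hNK.trans interior_subset).trans hKΩ) hNc
    (by positivity) huN (sub_mono hv subset_rfl (hNK.trans interior_subset)) le_rfl
    (θ := θ) (fun y hy => (hNsub hy).2.1.1) (fun y hy => (hNsub hy).2.1.2)
    (fun y hy => by rw [sub_zero]; exact (hNsub hy).2.2.1)
    (fun y hy => add_coe_add_add_coe_le (hmax y (hNK (hfr hy))) (by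
      have := mul_le_mul_of_nonneg_left (hηρ y hy) hε.le
      linarith))
    (fun y hy => by
      rw [add_assoc, ← EReal.coe_add]
      refine (add_le_add_left (hug y (hNK (hfr hy))) _).trans ?_
      rw [← EReal.coe_add]
      refine EReal.coe_le_coe_iff.2 ?_
      have h1 := mul_le_mul_of_nonneg_left (hηρ y hy) hε.le
      have h2 : g y - c < θ y := (hNsub (hfr hy)).2.2.2.1
      linarith) hxN
  simp only [ha, hb, hρ0] at hfin
  have h1 := EReal.coe_le_coe_iff.1 (show ((a + -(ε * 0 + (a + b - ε * η)) + (b + -0) : ℝ) : EReal)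
    ≤ ((0 : ℝ) : EReal) by exact_mod_cast hfin)
  have h2 := mul_pos hε hη
  linarith

/-- If `Fₓ` contains all jets of value less than `h`, the function that is `h - η` at `x` and `-∞`
elsewhere is strictly `F`-subharmonic. -/
theorem pointMass_mem_sub {F : Set (Jet2 m X)} {x : X} {h η : ℝ} (hη : 0 < η)
    (hF : ∀ j : JetFiber (m := m) x, j.1 < h → j ∈ fiber F x) (N : Set X) :
    (fun y => open Classical in if y = x then ((h - η : ℝ) : EReal) else ⊥) ∈
      Sub (strictPart F η) N := by
  classical
  have hopen : IsOpen {k : JetFiber (m := m) x | k.1 < h} :=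
    isOpen_lt continuous_fst continuous_const
  refine ⟨⟨fun y _ => UpperSemicontinuousAt.upperSemicontinuousWithinAt _ ?_, fun y _ => ?_⟩, ?_⟩
  · intro t ht
    by_cases hy : y = x
    · simp only [if_pos hy] at ht
      refine Filter.Eventually.of_forall fun z => ?_
      dsimp only
      split_ifs
      · exact ht
      · exact bot_le.trans_lt ht
    · simp only [if_neg hy] at ht
      filter_upwards [isOpen_compl_singleton.mem_nhds hy] with z hz
      rwa [if_neg (show z ≠ x from hz)]
  · dsimp only
    split_ifs
    · exact EReal.coe_lt_top _
    · exact bot_lt_top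
  · rintro y - φ ⟨hφ, -, hφy⟩
    by_cases hy : y = x
    · subst hy
      simp only [if_true, EReal.coe_eq_coe_iff] at hφy
      obtain ⟨j, hj⟩ : ∃ j : JetFiber (m := m) y, jetOf φ y = ⟨y, j⟩ := ⟨(jetOf φ y).jet, rfl⟩
      have hj1 : φ y = j.1 := congrArg (fun J : Jet2 m X => J.jet.1) hj
      rw [hj]
      refine ⟨hF j (by linarith), fun j' hj' => ?_⟩
      -- Jets of value below `h` form an open subset of the fibre, so boundary jets have value at
      -- least `h`.
      have h1 : h ≤ j'.1 := by
        by_contra! hlt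
        exact hj'.2 (interior_maximal (fun k hk => hF k hk) hopen hlt)
      refine le_trans ?_ (abs_fst_le_jetNorm _)
      change η ≤ |j.1 - j'.1|
      rw [abs_sub_comm]
      exact le_abs.2 (Or.inl (by linarith))
    -- Away from `x` the value is `-∞`, which no real-valued test attains.
    · simp only [if_neg hy] at hφy
      exact absurd hφy (EReal.coe_ne_bot _)

/-- If `Fₓ` contains all jets below the obstacle but not all jets, then dual subharmonic functions
for the obstacle subequation are at most `-g` at `x`. -/
theorem value_le_of_forall_lt_obstacle_mem {F : Set (Jet2 m X)} (hF : IsSubequation F) {g : X → ℝ}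
    (hg : Continuous g) {Ω : Set X} (hcomp : WeakComparison F Ω) {K : Set X} (hKΩ : K ⊆ Ω)
    {v : X → EReal} (hv : v ∈ Sub (dual (obstacle F g)) K) {x : X} (hx : x ∈ interior K) {b : ℝ}
    (hb : v x = b) (hlow : ∀ j : JetFiber (m := m) x, j.1 < g x → j ∈ fiber F x)
    {j : JetFiber (m := m) x} (hj : j ∉ fiber F x) {η : ℝ} (hη : 0 < η) : b ≤ -g x + 3 * η := by
  classical
  have : LocallyCompactSpace X := ChartedSpace.locallyCompactSpace (EuclideanSpace ℝ (Fin m)) X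
  -- The supremum `h` of the levels below which the fibre contains every jet is finite, since some
  -- jet is missing. The point mass can sit just below `h`, and a jet outside `F` can be found just
  -- above.
  set S : Set ℝ := {r | ∀ l : JetFiber (m := m) x, l.1 < r → l ∈ fiber F x} with hS
  have hSb : BddAbove S := ⟨j.1, fun r hr => by
    by_contra! h
    exact hj (hr j h)⟩
  have hgS : g x ∈ S := hlow
  set h := sSup S with hh
  have hgh : g x ≤ h := le_csSup hSb hgS
  have hlt : ∀ l : JetFiber (m := m) x, l.1 < h → l ∈ fiber F x := fun l hl => by
    obtain ⟨r, hr, hlr⟩ := exists_lt_of_lt_csSup ⟨_, hgS⟩ hl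
    exact hr l hlr
  obtain ⟨l, hl, hlF⟩ : ∃ l : JetFiber (m := m) x, l.1 < h + η ∧ l ∉ fiber F x := by
    by_contra! hcon
    have := le_csSup hSb (show h + η ∈ S from hcon)
    linarith
  obtain ⟨θ, hθ, hθx, hθF⟩ := hF.exists_notMem_of_le hlF hl.le
  -- As `θ x = h + η`, this shift brings `θ - s` to `g x - η` at `x`, below the obstacle.
  have hθg : θ x - (h - g x + 2 * η) < g x := by linarith
  have hxK : ∀ᶠ y in 𝓝 x, y ∈ interior K := isOpen_interior.mem_nhds hx
  obtain ⟨N, hN, hNsub, hNc⟩ := local_compact_nhds (hxK.and ((eventually_jetOf_notMem hF hθ hθF).and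
    ((hθ.continuousAt.sub_const _).eventually_lt hg.continuousAt hθg)))
  have hNK : N ⊆ interior K := fun y hy => (hNsub hy).1
  have hfr : ∀ y ∈ frontier N, y ≠ x := fun y hy e => hy.2 (e ▸ mem_interior_iff_mem_nhds.2 hN)
  -- Both frontier conditions are trivial, as the point mass is `-∞` there. At `x` comparison gives
  -- `h - η + v x - s ≤ 0`, which is the claim.
  have hfin := hcomp.add_sup_le hF hg ((hNK.trans interior_subset).trans hKΩ) hNc hη
    (pointMass_mem_sub hη hlt N) (sub_mono hv subset_rfl (hNK.trans interior_subset))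
    (s := h - g x + 2 * η) (by linarith)
    (θ := θ) (fun y hy => (hNsub hy).2.1.1) (fun y hy => (hNsub hy).2.1.2)
    (fun y hy => (hNsub hy).2.2) (fun y hy => by simp [hfr y hy]) (fun y hy => by simp [hfr y hy])
    (mem_of_mem_nhds hN)
  simp only [if_true, hb] at hfin
  have h1 := EReal.coe_le_coe_iff.1 (show ((h - η + (b + -(h - g x + 2 * η)) : ℝ) : EReal)
    ≤ ((0 : ℝ) : EReal) by exact_mod_cast hfin)
  linarith

theorem le_neg_obstacle_of_fiber_eq_univ {F : Set (Jet2 m X)} (hF : IsSubequation F) {g : X → ℝ}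
    (hg : Continuous g) {v : X → EReal} {U : Set X} (hU : IsOpen U)
    (hUF : ∀ y ∈ U, fiber F y = Set.univ) (hv : IsUSC U v)
    (hvt : TestsIn (dual (obstacle F g)) U v) {x : X} (hx : x ∈ U) :
    v x ≤ ((-g x : ℝ) : EReal) := by
  refine le_of_forall_isTest (m := m) (f := fun y => -g y) hU hx hv.1 hv.2 (by fun_prop)
    fun y hy φ hφ => ?_
  by_contra! h
  have h1 := mem_dual_of_mem_dual_obstacle hg (hvt y hy φ hφ) h
  rw [jetOf, hF.mem_dual_iff, hUF y hy, interior_univ] at h1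
  exact h1 trivial

theorem IsSubequation.weakComparison_obstacle {F : Set (Jet2 m X)} (hF : IsSubequation F)
    {g : X → ℝ} (hg : Continuous g) {Ω : Set X}
    (hopen : IsOpen {x ∈ Ω | fiber F x = Set.univ}) (hcomp : WeakComparison F Ω) :
    WeakComparison (obstacle F g) Ω := by
  intro K hKΩ hK c hc u hu v hv hfr z hz
  by_contra! hpos
  have husc : UpperSemicontinuousOn (fun y => u y + v y) K :=
    hu.1.1.add' hv.1.1 fun y hy => EReal.continuousAt_add (Or.inl (hu.1.2 y hy).ne)
      (Or.inr (hv.1.2 y hy).ne)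
  obtain ⟨x, hxK, hxmax⟩ := husc.exists_isMaxOn ⟨z, hz⟩ hK
  have hxpos : 0 < u x + v x := hpos.trans_le (hxmax hz)
  have hx : x ∈ interior K := by
    by_contra hni
    exact absurd hxpos (not_lt.2 (hfr x ⟨subset_closure hxK, hni⟩))
  have hub : u x ≠ ⊥ := fun e => by simp [e] at hxpos
  have hvb : v x ≠ ⊥ := fun e => by simp [e] at hxpos
  obtain ⟨a, ha⟩ : ∃ a : ℝ, u x = a := ⟨_, (EReal.coe_toReal (hu.1.2 x hxK).ne hub).symm⟩
  obtain ⟨b, hb⟩ : ∃ b : ℝ, v x = b := ⟨_, (EReal.coe_toReal (hv.1.2 x hxK).ne hvb).symm⟩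
  have hab : 0 < a + b := by
    rw [ha, hb, ← EReal.coe_add] at hxpos
    exact_mod_cast hxpos
  have hug : ∀ y ∈ interior K, u y ≤ ((g y - c : ℝ) : EReal) := fun y hy =>
    le_sub_of_testsIn hg hu.1 (fun J hJ => (strictPart_obstacle_subset hc hJ).2) hu.2 hy
  have hag : a ≤ g x - c := by
    have := hug x hx
    rw [ha] at this
    exact EReal.coe_le_coe_iff.1 this
  by_cases huniv : fiber F x = Set.univ
  · have hvx := le_neg_obstacle_of_fiber_eq_univ hF hg (hopen.inter isOpen_interior)
      (fun y hy => hy.1.2) (hv.1.mono fun y hy => interior_subset hy.2)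
      (hv.2.mono subset_rfl fun y hy => hy.2) (x := x) ⟨⟨hKΩ hxK, huniv⟩, hx⟩
    rw [hb] at hvx
    have := EReal.coe_le_coe_iff.1 hvx
    linarith
  by_cases hlow : ∀ j : JetFiber (m := m) x, j.1 < g x → j ∈ fiber F x
  · obtain ⟨j, hj⟩ := (Set.ne_univ_iff_exists_notMem _).1 huniv
    -- With `η = c / 3` the error `3η` is exactly the gap `c` in `a ≤ g x - c`, whence `a + b ≤ 0`.
    have := value_le_of_forall_lt_obstacle_mem hF hg hcomp hKΩ hv hx hb hlow hj
      (η := c / 3) (by positivity)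
    linarith
  · push Not at hlow
    obtain ⟨j, hjg, hj⟩ := hlow
    refine false_of_notMem_of_lt_obstacle hF hg hcomp hKΩ hc
      (sub_mono hu (fun J hJ => (strictPart_obstacle_subset hc hJ).1) subset_rfl)
      hug hv hx ha hb hab
      (fun y hy => ?_) hj hjg
    rw [EReal.coe_add, ← ha, ← hb]
    exact hxmax (interior_subset hy)

end Comparison

end Subeq

theorem lemma3p1 {m : ℕ} (hm : 1 ≤ m) {X : Type*} [TopologicalSpace X] [T2Space X]
    [ChartedSpace (EuclideanSpace ℝ (Fin m)) X] [IsManifold (𝓡 m) ∞ X]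
    [RiemannianBundle (fun x : X => TangentSpace (𝓡 m) x)]
    [IsContMDiffRiemannianBundle (𝓡 m) ∞ (EuclideanSpace ℝ (Fin m))
      (fun x : X => TangentSpace (𝓡 m) x)]
    (F : Set (Subeq.Jet2 m X)) (hF : Subeq.IsSubequation F)
    (g : X → ℝ) (hg : Continuous g) (Ω : Set X) (hΩ : IsOpen Ω) :
    (Subeq.StrictApproximation F Ω → Subeq.StrictApproximation (Subeq.obstacle F g) Ω) ∧
    (IsOpen {x ∈ Ω | Subeq.fiber F x = Set.univ} →
      Subeq.WeakComparison F Ω → Subeq.WeakComparison (Subeq.obstacle F g) Ω) := by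
  exact ⟨hF.strictApproximation_obstacle hg, hF.weakComparison_obstacle hg⟩
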